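/- **Conventions.** The statement holds in two versions: a Real one, in which all Real structures below are included, and a complex one, in which every Real structure and every condition on it is omitted. All gradings are $\mathbb Z/2\mathbb Z$-gradings. For a topological space $X$, its *k-ification* $kX$ is the set $X$ with the finest topology for which every continuous map $K\to X$ from a compact Hausdorff space $K$ stays continuous; $X$ is *compactly generated* if $kX=X$, and $X\times_{CG}Y:=k(X\times Y)$. * $\mathfrak C^*$ is the category of graded Real C*-algebras $(A,\varepsilon,\tau)$: complex C*-algebras $A$ (not necessarily unital) with a $*$-automorphism $\varepsilon$, $\varepsilon^2=1$, and a conjugate-linear $*$-automorphism $\tau$, $\tau^2=1$, such that $\varepsilon\tau=\tau\varepsilon$. Morphisms are the $*$-homomorphisms that commute with $\varepsilon$ and $\tau$. The set $\operatorname{Hom}(A,B)$ has the point-norm topology ($\varphi_i\to\varphi$ iff $\varphi_i(a)\to\varphi(a)$ for all $a\in A$), and as a morphism space of $\mathfrak C^*$ it carries the k-ification of this topology. * $\mathfrak H$ is the category of separable graded Real Hilbert spaces $\mathcal H=\mathcal H_0\oplus\mathcal H_1$ (orthogonal sum), the Real structure being a conjugate-linear involution $x\mapsto\overline x$ with $\langle\overline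 x,\overline y\rangle=\overline{\langle x,y\rangle}$ which preserves $\mathcal H_0$ and $\mathcal H_1$. Morphisms are the linear isometries (not necessarily surjective) which preserve the gradings and the Real structures. Morphism spaces carry the k-ification of the strong-$*$ topology ($V_i\to V$ iff $V_ix\to Vx$ and $V_i^*y\to V^*y$ for all $x,y$). * $\mathfrak{Top}^{CG}_*$ is the category of pointed compactly generated spaces and based continuous maps; the morphism space $\operatorname{Map}(X,Y)$ is the k-ification of the compact-open topology, generated by the sets $\{f : f(u(K))\subseteq U\}$ with $u:K\to X$ a continuous map from a compact Hausdorff space and $U\subseteq Y$ open. A category is *topologically enriched* if each morphism set is a compactly generated space and the compositions $\operatorname{Hom}(X,Y)\times_{CG}\operatorname{Hom}(Y,Z)\to\operatorname{Hom}(X,Z)$ are continuous. A functor $F$ between topologically enriched categories is *topologically enriched* if all the maps $\operatorname{Hom}(X,Y)\to\operatorname{Hom}(FX,FY)$ are continuous. The three categories above are topologically enriched, and so is $\mathfrak C^*\times\mathfrak H$, with morphism spaces the products $\times_{CG}$. For graded Real C*-algebras $A,B$, the *maximal graded tensor product* $A\hat\otimes B$ is the completion, in the largest C*-seminorm, of the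 algebraic tensor product over $\mathbb C$ with $(a\otimes b)(a'\otimes b')=(-1)^{\partial b\,\partial a'}aa'\otimes bb'$ and $(a\otimes b)^*=(-1)^{\partial a\,\partial b}a^*\otimes b^*$ for homogeneous elements, with grading $\varepsilon_A\otimes\varepsilon_B$ and Real structure $\tau_A\otimes\tau_B$. For $\mathcal H\in\mathfrak H$, the algebra $\mathcal K(\mathcal H)$ of compact operators is graded by $T\mapsto\gamma T\gamma$, where $\gamma=\pm1$ on $\mathcal H_0$ and $\mathcal H_1$ respectively, with Real structure $\tau(T)x=\overline{T\overline x}$. Let $\mathcal S=C_0(\mathbb R)$, graded by $f(x)\mapsto f(-x)$, with Real structure $f\mapsto\overline f$. Let $\mathbb K(A,\mathcal H):=\operatorname{Hom}(\mathcal S,A\hat\otimes\mathcal K(\mathcal H))$ with the point-norm topology, based at the zero homomorphism. A pair of a morphism $\varphi:A\to B$ of $\mathfrak C^*$ and a morphism $V:\mathcal H\to\mathcal H'$ of $\mathfrak H$ induces the map $\mathbb K(A,\mathcal H)\to\mathbb K(B,\mathcal H')$, $\psi\mapsto(\varphi\hat\otimes\operatorname{Ad}V)\circ\psi$, where $\operatorname{Ad}V(T)=VTV^*$.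 **Theorem.** The functor $$k\mathbb K(-,-):\ \mathfrak C^*\times\mathfrak H\longrightarrow\mathfrak{Top}^{CG}_*,\qquad (A,\mathcal H)\longmapsto k\,\mathbb K(A,\mathcal H),$$ is topologically enriched. That is, for all $A,B\in\mathfrak C^*$ and $\mathcal H,\mathcal H'\in\mathfrak H$, the map $$k\operatorname{Hom}(A,B)\times_{CG}k\operatorname{Iso}^{ev}(\mathcal H,\mathcal H')\longrightarrow\operatorname{Map}\bigl(k\mathbb K(A,\mathcal H),k\mathbb K(B,\mathcal H')\bigr)$$ given by $(\varphi,V)\mapsto\bigl(\psi\mapsto(\varphi\hat\otimes\operatorname{Ad}V)\circ\psi\bigr)$ is continuous, where $\operatorname{Iso}^{ev}(\mathcal H,\mathcal H')$ is the set of morphisms $\mathcal H\to\mathcal H'$ of $\mathfrak H$ with the strong-$*$ topology. -/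

import Mathlib

open scoped TensorProduct

universe u v w

noncomputable section

namespace SpectralKTheory

/-! ### C*-seminorms and the C*-algebras they generate -/

/-- A C*-seminorm on a complex `*`-algebra. -/
structure CStarSeminorm (R : Type u) [NonUnitalRing R] [StarRing R] [Module ℂ R] where
  toFun : R → ℝ
  add_le : ∀ x y, toFun (x + y) ≤ toFun x + toFun y
  smul : ∀ (z : ℂ) x, toFun (z • x) = ‖z‖ * toFun x
  mul_le : ∀ x y, toFun (x * y) ≤ toFun x * toFun y
  star_mul_self : ∀ x, toFun (star x * x) = toFun x * toFun x

namespace CStarSeminorm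

section

variable {R : Type u} [NonUnitalRing R] [StarRing R] [Module ℂ R]

instance : CoeFun (CStarSeminorm R) (fun _ => R → ℝ) := ⟨toFun⟩

theorem zero_eq (p : CStarSeminorm R) : p 0 = 0 := by
  have := p.smul 0 0
  simpa using this

theorem neg_eq (p : CStarSeminorm R) (x : R) : p (-x) = p x := by
  have := p.smul (-1) x
  simpa using this

theorem nonneg (p : CStarSeminorm R) (x : R) : 0 ≤ p x := by
  have h := p.add_le x (-x)
  rw [add_neg_cancel, p.zero_eq, p.neg_eq] at h
  linarith

theorem le_star (p : CStarSeminorm R) (x : R) : p x ≤ p (star x) := by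
  have h := p.mul_le (star x) x
  rw [p.star_mul_self] at h
  rcases (p.nonneg x).eq_or_lt with h0 | h0
  · rw [← h0]; exact p.nonneg _
  · exact le_of_mul_le_mul_right h h0

theorem star_eq (p : CStarSeminorm R) (x : R) : p (star x) = p x :=
  le_antisymm (by simpa using p.le_star (Star.star x)) (p.le_star x)

/-- The `*`-algebra `R`, seminormed by `p`. -/
def Space (_p : CStarSeminorm R) : Type u := R

instance (p : CStarSeminorm R) : NonUnitalRing p.Space := inferInstanceAs (NonUnitalRing R)
instance (p : CStarSeminorm R) : StarRing p.Space := inferInstanceAs (StarRing R)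
instance (p : CStarSeminorm R) : Module ℂ p.Space := inferInstanceAs (Module ℂ R)

instance (p : CStarSeminorm R) : SeminormedAddCommGroup p.Space :=
  AddGroupSeminorm.toSeminormedAddCommGroup
    { toFun := p.toFun
      map_zero' := p.zero_eq
      add_le' := p.add_le
      neg' := p.neg_eq }

instance (p : CStarSeminorm R) : NonUnitalSeminormedRing p.Space where
  __ := (inferInstance : NonUnitalRing p.Space)
  __ := (inferInstance : SeminormedAddCommGroup p.Space)
  norm_mul_le := p.mul_le

instance (p : CStarSeminorm R) : NormedSpace ℂ p.Space where
  norm_smul_le z x := (p.smul z x).le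

instance (p : CStarSeminorm R) : NormedStarGroup p.Space where
  norm_star_le x := (p.star_eq x).le

/-- The canonical map from `R` to `R` seminormed by `p`. -/
def toSpace (p : CStarSeminorm R) (x : R) : p.Space := x

theorem norm_toSpace (p : CStarSeminorm R) (x : R) : ‖p.toSpace x‖ = p x := rfl

/-- The Hausdorff completion of `R` with respect to `p`. -/
def Completion (p : CStarSeminorm R) : Type u := UniformSpace.Completion p.Space

instance (p : CStarSeminorm R) : NormedAddCommGroup p.Completion :=
  inferInstanceAs (NormedAddCommGroup (UniformSpace.Completion p.Space))

/-- An element of the completion, in the underlying uniform completion. -/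
def base (p : CStarSeminorm R) (x : p.Completion) : UniformSpace.Completion p.Space := x

/-- Scalar multiplication on the completion. It is irreducible so that unification does not unfold
it. -/
@[irreducible]
def smulAux (p : CStarSeminorm R) (z : ℂ) (x : p.Completion) : p.Completion :=
  z • p.base x

theorem smulAux_eq (p : CStarSeminorm R) (z : ℂ) (x : p.Completion) :
    p.smulAux z x = z • p.base x := by
  unfold smulAux; rfl

instance (p : CStarSeminorm R) : NormedSpace ℂ p.Completion where
  smul := p.smulAux
  one_smul x := (p.smulAux_eq 1 x).trans (one_smul ℂ (p.base x))
  mul_smul z w x := by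
    change p.smulAux _ _ = p.smulAux _ (p.smulAux _ _)
    rw [smulAux_eq, smulAux_eq, smulAux_eq]
    exact mul_smul z w (p.base x)
  smul_zero z := (p.smulAux_eq z 0).trans (smul_zero (A := UniformSpace.Completion p.Space) z)
  smul_add z x y := by
    change p.smulAux _ _ = p.smulAux _ _ + p.smulAux _ _
    rw [smulAux_eq, smulAux_eq, smulAux_eq]
    exact smul_add z (p.base x) y
  add_smul z w x := by
    change p.smulAux _ _ = p.smulAux _ _ + p.smulAux _ _
    rw [smulAux_eq, smulAux_eq, smulAux_eq]
    exact add_smul z w (p.base x)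
  zero_smul x := (p.smulAux_eq 0 x).trans (zero_smul ℂ (p.base x))
  norm_smul_le z x := by
    change ‖p.smulAux _ _‖ ≤ _
    rw [smulAux_eq]
    exact norm_smul_le z (p.base x)
instance (p : CStarSeminorm R) : CompleteSpace p.Completion :=
  inferInstanceAs (CompleteSpace (UniformSpace.Completion p.Space))

theorem continuous_smul' (p : CStarSeminorm R) (z : ℂ) :
    Continuous fun x : p.Completion => z • x := continuous_const_smul z

/-- The canonical linear map from `R` to its completion. -/
def of (p : CStarSeminorm R) : R →ₗ[ℂ] p.Completion where
  toFun x := ((p.toSpace x : p.Space) : UniformSpace.Completion p.Space)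
  map_add' x y := UniformSpace.Completion.coe_add (p.toSpace x) (p.toSpace y)
  map_smul' z x :=
    (UniformSpace.Completion.coe_smul z (p.toSpace x)).trans (p.smulAux_eq z _).symm

theorem norm_of (p : CStarSeminorm R) (x : R) : ‖p.of x‖ = p x :=
  UniformSpace.Completion.norm_coe (p.toSpace x)

theorem denseRange_of (p : CStarSeminorm R) : DenseRange p.of :=
  UniformSpace.Completion.denseRange_coe (α := p.Space)

@[elab_as_elim]
theorem induction {p : CStarSeminorm R} {P : p.Completion → Prop}
    (hc : IsClosed {x | P x}) (h : ∀ r, P (p.of r)) (x : p.Completion) : P x :=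
  p.denseRange_of.induction_on x hc h

/-- A map out of `R` which is Lipschitz for `p` extends to the completion. -/
def extend {E : Type w} [NormedAddCommGroup E] [CompleteSpace E] (p : CStarSeminorm R)
    (f : R → E) : p.Completion → E :=
  UniformSpace.Completion.extension (α := p.Space) f

theorem lipschitz_aux {E : Type w} [NormedAddCommGroup E] (p : CStarSeminorm R)
    {f : R → E} (hadd : ∀ x y, f (x + y) = f x + f y) {C : ℝ} (hf : ∀ x, ‖f x‖ ≤ C * p x) :
    UniformContinuous (fun x : p.Space => f x) := by
  let g : p.Space →+ E := AddMonoidHom.mk' f hadd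
  exact (AddMonoidHomClass.lipschitz_of_bound g C hf).uniformContinuous

theorem extend_of {E : Type w} [NormedAddCommGroup E] [CompleteSpace E] (p : CStarSeminorm R)
    {f : R → E} (hadd : ∀ x y, f (x + y) = f x + f y) {C : ℝ} (hf : ∀ x, ‖f x‖ ≤ C * p x) (x : R) :
    p.extend f (p.of x) = f x :=
  UniformSpace.Completion.extension_coe (p.lipschitz_aux hadd hf) (p.toSpace x)

theorem continuous_extend {E : Type w} [NormedAddCommGroup E] [CompleteSpace E]
    (p : CStarSeminorm R) (f : R → E) : Continuous (p.extend f) :=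
  UniformSpace.Completion.continuous_extension

end

section

variable {R : Type u} [NonUnitalRing R] [StarRing R] [Module ℂ R] 
  (p : CStarSeminorm R)

instance : Star p.Completion := ⟨p.extend fun x => p.of (Star.star x)⟩

theorem star_of (x : R) : Star.star (p.of x) = p.of (Star.star x) :=
  p.extend_of (f := fun x => p.of (Star.star x)) (by simp) (C := 1)
    (fun x => by rw [norm_of, p.star_eq, one_mul]) x

theorem continuous_star' : Continuous (Star.star : p.Completion → p.Completion) :=
  p.continuous_extend _

/-- Multiplication on the left by an element of `R`. -/
def mulLeft (x : R) : p.Completion → p.Completion := p.extend fun y => p.of (x * y)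

theorem mulLeft_of (x y : R) : p.mulLeft x (p.of y) = p.of (x * y) :=
  p.extend_of (f := fun y => p.of (x * y)) (by simp [mul_add]) (C := p x)
    (fun y => by rw [norm_of]; exact p.mul_le x y) y

theorem mulLeft_add (x x' : R) (y : p.Completion) :
    p.mulLeft (x + x') y = p.mulLeft x y + p.mulLeft x' y := by
  induction y using induction with
  | hc => exact isClosed_eq (p.continuous_extend _) ((p.continuous_extend _).add (p.continuous_extend _))
  | h r =>
    simp [mulLeft_of, add_mul]

theorem norm_mulLeft_le (y : p.Completion) (x : R) : ‖p.mulLeft x y‖ ≤ ‖y‖ * p x := by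
  induction y using induction with
  | hc => exact isClosed_le (p.continuous_extend _).norm (by fun_prop)
  | h r =>
    rw [mulLeft_of, norm_of, norm_of, mul_comm]; exact p.mul_le x r

instance : Mul p.Completion := ⟨fun x y => p.extend (fun r => p.mulLeft r y) x⟩

theorem of_mul_eq (x : R) (y : p.Completion) : p.of x * y = p.mulLeft x y :=
  p.extend_of (f := fun r => p.mulLeft r y) (fun a b => p.mulLeft_add a b y) (p.norm_mulLeft_le y) x

theorem of_mul (x y : R) : p.of (x * y) = p.of x * p.of y := by
  rw [of_mul_eq, mulLeft_of]

theorem continuous_mul_right (y : p.Completion) : Continuous fun x : p.Completion => x * y :=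
  p.continuous_extend _

theorem norm_mul_le' (x y : p.Completion) : ‖x * y‖ ≤ ‖x‖ * ‖y‖ := by
  induction x using induction with
  | hc => exact isClosed_le (p.continuous_mul_right y).norm (by fun_prop)
  | h r =>
    rw [of_mul_eq, norm_of, mul_comm]
    exact p.norm_mulLeft_le y r

theorem mul_add' (x y z : p.Completion) : x * (y + z) = x * y + x * z := by
  induction x using induction with
  | hc => exact isClosed_eq (p.continuous_mul_right _) ((p.continuous_mul_right _).add (p.continuous_mul_right _))
  | h r =>
    rw [of_mul_eq, of_mul_eq, of_mul_eq]
    induction y using induction with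
    | hc => exact isClosed_eq ((p.continuous_extend _).comp (continuous_add_const _)) ((p.continuous_extend _).add continuous_const)
    | h s =>
      induction z using induction with
      | hc => exact isClosed_eq ((p.continuous_extend _).comp (continuous_const_add _)) (continuous_const.add (p.continuous_extend _))
      | h t =>
        rw [← map_add, mulLeft_of, mulLeft_of, mulLeft_of, mul_add, map_add]

theorem add_mul' (x y z : p.Completion) : (x + y) * z = x * z + y * z := by
  induction x using induction with
  | hc => exact isClosed_eq ((p.continuous_mul_right z).comp (continuous_add_const _)) ((p.continuous_mul_right _).add continuous_const)
  | h r =>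
    induction y using induction with
    | hc => exact isClosed_eq ((p.continuous_mul_right z).comp (continuous_const_add _)) (continuous_const.add (p.continuous_mul_right _))
    | h s =>
      rw [← map_add, of_mul_eq, of_mul_eq, of_mul_eq, mulLeft_add]

instance : NonUnitalNonAssocRing p.Completion where
  left_distrib := p.mul_add'
  right_distrib := p.add_mul'
  zero_mul x := by
    have := p.add_mul' 0 0 x
    simpa using this
  mul_zero x := by
    have := p.mul_add' x 0 0
    simpa using this

theorem continuous_mul' : Continuous fun q : p.Completion × p.Completion => q.1 * q.2 := by
  rw [continuous_iff_continuousAt]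
  rintro ⟨x, y⟩
  let M : p.Completion →+ p.Completion →+ p.Completion := AddMonoidHom.mul
  have key : ∀ q : p.Completion × p.Completion,
      ‖q.1 * q.2 - x * y‖ ≤ ‖q.1 - x‖ * ‖q.2‖ + ‖x‖ * ‖q.2 - y‖ := fun q => by
    have : q.1 * q.2 - x * y = (q.1 - x) * q.2 + x * (q.2 - y) := by
      rw [sub_mul, mul_sub]; abel
    rw [this]
    exact (norm_add_le _ _).trans (add_le_add (p.norm_mul_le' _ _) (p.norm_mul_le' _ _))
  unfold ContinuousAt
  rw [tendsto_iff_norm_sub_tendsto_zero]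
  refine squeeze_zero (fun _ => norm_nonneg _) key ?_
  have : Continuous fun q : p.Completion × p.Completion =>
      ‖q.1 - x‖ * ‖q.2‖ + ‖x‖ * ‖q.2 - y‖ := by fun_prop
  simpa using this.tendsto (x, y)

instance : ContinuousMul p.Completion := ⟨p.continuous_mul'⟩

instance : NonUnitalNormedRing p.Completion where
  __ := (inferInstance : NonUnitalNonAssocRing p.Completion)
  __ := (inferInstance : NormedAddCommGroup p.Completion)
  norm_mul_le := p.norm_mul_le'
  mul_assoc x y z := by
    induction x using induction with
    | hc => exact isClosed_eq (by fun_prop) (by fun_prop)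
    | h r =>
      induction y using induction with
      | hc => exact isClosed_eq (by fun_prop) (by fun_prop)
      | h s =>
        induction z using induction with
        | hc => exact isClosed_eq (by fun_prop) (by fun_prop)
        | h t =>
          rw [← of_mul, ← of_mul, ← of_mul, ← of_mul, mul_assoc]

instance : ContinuousStar p.Completion := ⟨p.continuous_star'⟩

instance : StarRing p.Completion where
  star_involutive x := by
    induction x using induction with
    | hc => exact isClosed_eq (by fun_prop) (by fun_prop)
    | h r =>
      rw [star_of, star_of, star_star]
  star_mul x y := by
    induction x using induction with
    | hc => exact isClosed_eq (by fun_prop) (by fun_prop)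
    | h r =>
      induction y using induction with
      | hc => exact isClosed_eq (by fun_prop) (by fun_prop)
      | h s =>
        rw [← of_mul, star_of, star_of, star_of, ← of_mul, star_mul]
  star_add x y := by
    induction x using induction with
    | hc => exact isClosed_eq (by fun_prop) (by fun_prop)
    | h r =>
      induction y using induction with
      | hc => exact isClosed_eq (by fun_prop) (by fun_prop)
      | h s =>
        rw [← map_add, star_of, star_of, star_of, star_add, map_add]

instance : CStarRing p.Completion where
  norm_mul_self_le x := by
    induction x using induction with
    | hc =>
      exact isClosed_le (continuous_norm.mul continuous_norm)
        (p.continuous_mul'.comp (p.continuous_star'.prodMk continuous_id)).norm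
    | h r => rw [star_of, ← of_mul, norm_of, norm_of, p.star_mul_self]

instance [IsScalarTower ℂ R R] : IsScalarTower ℂ p.Completion p.Completion where
  smul_assoc z x y := by
    change (z • x) * y = z • (x * y)
    induction x using induction with
    | hc =>
      exact isClosed_eq ((p.continuous_mul_right y).comp (p.continuous_smul' z))
        ((p.continuous_smul' z).comp (p.continuous_mul_right y))
    | h r =>
      induction y using induction with
      | hc =>
        exact isClosed_eq (continuous_const_mul _)
          ((p.continuous_smul' z).comp (continuous_const_mul _))
      | h s => rw [← map_smul, ← of_mul, ← of_mul, ← map_smul, smul_mul_assoc]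

instance [SMulCommClass ℂ R R] : SMulCommClass ℂ p.Completion p.Completion where
  smul_comm z x y := by
    change z • (x * y) = x * (z • y)
    induction x using induction with
    | hc =>
      exact isClosed_eq ((p.continuous_smul' z).comp (p.continuous_mul_right y))
        (p.continuous_mul_right _)
    | h r =>
      induction y using induction with
      | hc =>
        exact isClosed_eq ((p.continuous_smul' z).comp (continuous_const_mul _))
          ((continuous_const_mul _).comp (p.continuous_smul' z))
      | h s => rw [← map_smul, ← of_mul, ← of_mul, ← map_smul, mul_smul_comm]

instance [StarModule ℂ R] : StarModule ℂ p.Completion where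
  star_smul z x := by
    induction x using induction with
    | hc =>
      exact isClosed_eq (p.continuous_star'.comp (p.continuous_smul' z))
        ((p.continuous_smul' _).comp p.continuous_star')
    | h r => rw [← map_smul, star_of, star_of, star_smul, map_smul]

/-- The completion of a `*`-algebra in a C*-seminorm is a C*-algebra. -/
instance [IsScalarTower ℂ R R] [SMulCommClass ℂ R R] [StarModule ℂ R] :
    NonUnitalCStarAlgebra p.Completion where

/-- The canonical `*`-homomorphism from `R` to its completion. -/
def ofHom : R →⋆ₙₐ[ℂ] p.Completion where
  __ := p.of
  map_smul' := p.of.map_smul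
  map_zero' := map_zero p.of
  map_mul' := p.of_mul
  map_star' x := (p.star_of x).symm

end

end CStarSeminorm


/-! ### Graded (Real) C*-algebras -/

/-- A `ℤ/2`-graded C*-algebra (possibly without unit), with a Real structure if `IsReal` holds.
For `IsReal = True` these are the graded Real C*-algebras, and for `IsReal = False` they are the
graded complex C*-algebras: the field `conj` then carries no data and the laws about it are void. -/
structure GradedCStarAlg (IsReal : Prop) : Type (u + 1) where
  carrier : Type u
  [cstar : NonUnitalCStarAlgebra carrier]
  /-- the grading automorphism -/
  grading : carrier →⋆ₙₐ[ℂ] carrier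
  grading_grading : ∀ a, grading (grading a) = a
  /-- the Real structure, an involutive antilinear `*`-automorphism -/
  conj : IsReal → carrier → carrier
  conj_add : ∀ h a b, conj h (a + b) = conj h a + conj h b
  conj_smul : ∀ h (z : ℂ) a, conj h (z • a) = starRingEnd ℂ z • conj h a
  conj_mul : ∀ h a b, conj h (a * b) = conj h a * conj h b
  conj_star : ∀ h a, conj h (star a) = star (conj h a)
  conj_conj : ∀ h a, conj h (conj h a) = a
  conj_grading : ∀ h a, conj h (grading a) = grading (conj h a)

variable {IsReal : Prop}

instance : CoeSort (GradedCStarAlg.{u} IsReal) (Type u) := ⟨GradedCStarAlg.carrier⟩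

instance (A : GradedCStarAlg.{u} IsReal) : NonUnitalCStarAlgebra A := A.cstar

namespace GradedCStarAlg

/-- A graded (Real) `*`-homomorphism. -/
@[ext]
structure Hom (A : GradedCStarAlg.{u} IsReal) (B : GradedCStarAlg.{v} IsReal) :
    Type (max u v) where
  toHom : A →⋆ₙₐ[ℂ] B
  map_grading : ∀ a, toHom (A.grading a) = B.grading (toHom a)
  map_conj : ∀ h a, toHom (A.conj h a) = B.conj h (toHom a)

instance (A : GradedCStarAlg.{u} IsReal) (B : GradedCStarAlg.{v} IsReal) :
    CoeFun (Hom A B) (fun _ => A → B) := ⟨fun f => f.toHom⟩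

theorem Hom.ext' {A : GradedCStarAlg.{u} IsReal} {B : GradedCStarAlg.{v} IsReal} {f g : Hom A B}
    (h : ∀ a, f a = g a) : f = g :=
  Hom.ext (NonUnitalStarAlgHom.ext h)

/-- The identity homomorphism. -/
def Hom.id (A : GradedCStarAlg.{u} IsReal) : Hom A A where
  toHom := NonUnitalStarAlgHom.id ℂ A
  map_grading _ := rfl
  map_conj _ _ := rfl

/-- The composite `g ∘ f`. -/
def Hom.comp {A : GradedCStarAlg.{u} IsReal} {B : GradedCStarAlg.{v} IsReal}
    {C : GradedCStarAlg.{w} IsReal} (g : Hom B C) (f : Hom A B) : Hom A C where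
  toHom := g.toHom.comp f.toHom
  map_grading a := by simp [f.map_grading, g.map_grading]
  map_conj h a := by simp [f.map_conj, g.map_conj]

instance (A : GradedCStarAlg.{u} IsReal) (B : GradedCStarAlg.{v} IsReal) : Zero (Hom A B) where
  zero :=
    { toHom := 0
      map_grading := fun a => by simp
      map_conj := fun h a => by
        have h0 := B.conj_smul h 0 0
        simp only [zero_smul, map_zero] at h0
        simp [h0] }

/-- The point-norm topology. -/
instance pointNorm (A : GradedCStarAlg.{u} IsReal) (B : GradedCStarAlg.{v} IsReal) :
    TopologicalSpace (Hom A B) :=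
  TopologicalSpace.induced (fun f a => f a) (inferInstance : TopologicalSpace (A → B))

/-! ### The algebraic graded tensor product -/

section

variable (A : GradedCStarAlg.{u} IsReal)

/-- Projection onto the even part. -/
def even : A →ₗ[ℂ] A := (2⁻¹ : ℂ) • (LinearMap.id + (A.grading : A →ₗ[ℂ] A))

/-- Projection onto the odd part. -/
def odd : A →ₗ[ℂ] A := (2⁻¹ : ℂ) • (LinearMap.id - (A.grading : A →ₗ[ℂ] A))

/-- The Real structure as a semilinear map. -/
def conjₛₗ (h : IsReal) : A →ₛₗ[starRingEnd ℂ] A where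
  toFun := A.conj h
  map_add' := A.conj_add h
  map_smul' := A.conj_smul h

/-- The involution as a semilinear map. -/
def starₛₗ : A →ₛₗ[starRingEnd ℂ] A where
  toFun := star
  map_add' := star_add
  map_smul' := star_smul

theorem even_apply (b : A) : A.even b = (2⁻¹ : ℂ) • (b + A.grading b) := rfl

theorem odd_apply (b : A) : A.odd b = (2⁻¹ : ℂ) • (b - A.grading b) := rfl

theorem even_add_odd (b : A) : A.even b + A.odd b = b := by
  rw [even_apply, odd_apply, ← smul_add, add_add_sub_cancel, ← two_smul ℂ b, smul_smul]
  norm_num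

theorem grading_even (b : A) : A.grading (A.even b) = A.even b := by
  rw [even_apply, map_smul, map_add, grading_grading, add_comm]

theorem grading_odd (b : A) : A.grading (A.odd b) = -A.odd b := by
  rw [odd_apply, map_smul, map_sub, grading_grading, ← smul_neg, neg_sub]

theorem even_of_even {b : A} (h : A.grading b = b) : A.even b = b := by
  rw [even_apply, h, ← two_smul ℂ b, smul_smul]; norm_num

theorem odd_of_even {b : A} (h : A.grading b = b) : A.odd b = 0 := by
  rw [odd_apply, h, sub_self, smul_zero]

theorem even_of_odd {b : A} (h : A.grading b = -b) : A.even b = 0 := by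
  rw [even_apply, h, add_neg_cancel, smul_zero]

theorem odd_of_odd {b : A} (h : A.grading b = -b) : A.odd b = b := by
  rw [odd_apply, h, sub_neg_eq_add, ← two_smul ℂ b, smul_smul]; norm_num

theorem even_even (b : A) : A.even (A.even b) = A.even b := A.even_of_even (A.grading_even b)
theorem odd_even (b : A) : A.odd (A.even b) = 0 := A.odd_of_even (A.grading_even b)
theorem even_odd (b : A) : A.even (A.odd b) = 0 := A.even_of_odd (A.grading_odd b)
theorem odd_odd (b : A) : A.odd (A.odd b) = A.odd b := A.odd_of_odd (A.grading_odd b)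

theorem even_star (b : A) : A.even (star b) = star (A.even b) := by
  simp [even_apply, star_smul, map_star]

theorem odd_star (b : A) : A.odd (star b) = star (A.odd b) := by
  simp [odd_apply, star_smul, map_star]

theorem even_even_mul (b c : A) : A.even (A.even b * c) = A.even b * A.even c := by
  rw [even_apply A (_ * _), map_mul, grading_even, ← mul_add, ← mul_smul_comm, ← even_apply]

theorem odd_even_mul (b c : A) : A.odd (A.even b * c) = A.even b * A.odd c := by
  rw [odd_apply A (_ * _), map_mul, grading_even, ← mul_sub, ← mul_smul_comm, ← odd_apply]

theorem even_odd_mul (b c : A) : A.even (A.odd b * c) = A.odd b * A.odd c := by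
  rw [even_apply A (_ * _), map_mul, grading_odd, neg_mul, ← sub_eq_add_neg, ← mul_sub,
    ← mul_smul_comm, ← odd_apply]

theorem odd_odd_mul (b c : A) : A.odd (A.odd b * c) = A.odd b * A.even c := by
  rw [odd_apply A (_ * _), map_mul, grading_odd, neg_mul, sub_neg_eq_add, ← mul_add,
    ← mul_smul_comm, ← even_apply]

theorem even_grading (b : A) : A.even (A.grading b) = A.even b := by
  rw [even_apply, even_apply, grading_grading, add_comm]

theorem odd_grading (b : A) : A.odd (A.grading b) = -A.odd b := by
  rw [odd_apply, odd_apply, grading_grading, ← smul_neg, neg_sub]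

theorem conj_even (h : IsReal) (b : A) : A.conj h (A.even b) = A.even (A.conj h b) := by
  rw [even_apply, even_apply, conj_smul, conj_add, conj_grading, map_inv₀, map_ofNat]

theorem conj_odd (h : IsReal) (b : A) : A.conj h (A.odd b) = A.odd (A.conj h b) := by
  have hn : A.conj h (b - A.grading b) = A.conj h b - A.conj h (A.grading b) :=
    (A.conjₛₗ h).map_sub _ _
  rw [odd_apply, odd_apply, conj_smul, hn, conj_grading, map_inv₀, map_ofNat]

end

theorem Hom.map_even {A B : GradedCStarAlg.{u} IsReal} (f : Hom A B) (a : A) :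
    f (A.even a) = B.even (f a) := by
  rw [even_apply, even_apply, map_smul, map_add, f.map_grading]

theorem Hom.map_odd {A B : GradedCStarAlg.{u} IsReal} (f : Hom A B) (a : A) :
    f (A.odd a) = B.odd (f a) := by
  rw [odd_apply, odd_apply, map_smul, map_sub, f.map_grading]

/-- The algebraic graded tensor product of `A` and `B`: the vector space `A ⊗ B`, with the
product `(a ⊗ b) (a' ⊗ b') = (-1) ^ (∂b ∂a') (a a' ⊗ b b')` and the involution
`(a ⊗ b)⋆ = (-1) ^ (∂a ∂b) (a⋆ ⊗ b⋆)` of homogeneous elements. -/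
def AlgTensor (A B : GradedCStarAlg.{u} IsReal) : Type u := A ⊗[ℂ] B

namespace AlgTensor

variable (A B : GradedCStarAlg.{u} IsReal)

instance : AddCommGroup (AlgTensor A B) := inferInstanceAs (AddCommGroup (A ⊗[ℂ] B))
instance : Module ℂ (AlgTensor A B) := inferInstanceAs (Module ℂ (A ⊗[ℂ] B))

variable {A B}

/-- The elementary tensor `a ⊗ b`. -/
def tmul (a : A) (b : B) : AlgTensor A B := a ⊗ₜ[ℂ] b

@[elab_as_elim]
theorem induction {P : AlgTensor A B → Prop} (zero : P 0) (tmul : ∀ a b, P (tmul a b))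
    (add : ∀ x y, P x → P y → P (x + y)) (x : AlgTensor A B) : P x :=
  TensorProduct.induction_on (motive := P) x zero tmul add

theorem add_tmul (a a' : A) (b : B) : tmul (a + a') b = tmul a b + tmul a' b :=
  TensorProduct.add_tmul a a' b

theorem tmul_add (a : A) (b b' : B) : tmul a (b + b') = tmul a b + tmul a b' :=
  TensorProduct.tmul_add a b b'

theorem zero_tmul (b : B) : tmul (0 : A) b = 0 := TensorProduct.zero_tmul _ _

theorem tmul_zero (a : A) : tmul a (0 : B) = 0 := TensorProduct.tmul_zero _ _

theorem neg_tmul (a : A) (b : B) : tmul (-a) b = -tmul a b := TensorProduct.neg_tmul a b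

theorem tmul_neg (a : A) (b : B) : tmul a (-b) = -tmul a b := TensorProduct.tmul_neg a b

variable (A B)

/-- Multiplication, as a bilinear map. On elementary tensors it is
`(a ⊗ b) (a' ⊗ b') = a a' ⊗ b₀ b' + a ε(a') ⊗ b₁ b'`, where `b₀` and `b₁` are the even and odd part
of `b` and `ε` is the grading of `A`. -/
def mulHom : AlgTensor A B →ₗ[ℂ] AlgTensor A B →ₗ[ℂ] AlgTensor A B :=
  (TensorProduct.map₂ (LinearMap.mul ℂ A) (LinearMap.mul ℂ B ∘ₗ B.even) +
    TensorProduct.map₂ ((LinearMap.mul ℂ A).compl₂ (A.grading : A →ₗ[ℂ] A))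
      (LinearMap.mul ℂ B ∘ₗ B.odd) : A ⊗[ℂ] B →ₗ[ℂ] A ⊗[ℂ] B →ₗ[ℂ] A ⊗[ℂ] B)

/-- The involution, as an antilinear map. On elementary tensors it is
`(a ⊗ b)⋆ = a⋆ ⊗ b₀⋆ + ε(a)⋆ ⊗ b₁⋆`. -/
def starHom : AlgTensor A B →ₛₗ[starRingEnd ℂ] AlgTensor A B :=
  (TensorProduct.map A.starₛₗ (B.starₛₗ.comp B.even) +
    TensorProduct.map (A.starₛₗ.comp (A.grading : A →ₗ[ℂ] A)) (B.starₛₗ.comp B.odd) :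
      A ⊗[ℂ] B →ₛₗ[starRingEnd ℂ] A ⊗[ℂ] B)

instance : Mul (AlgTensor A B) := ⟨fun x y => mulHom A B x y⟩
instance : Star (AlgTensor A B) := ⟨fun x => starHom A B x⟩

variable {A B}

theorem mul_def (x y : AlgTensor A B) : x * y = mulHom A B x y := rfl
theorem star_def (x : AlgTensor A B) : star x = starHom A B x := rfl

theorem tmul_mul_tmul (a a' : A) (b b' : B) :
    tmul a b * tmul a' b' =
      tmul (a * a') (B.even b * b') + tmul (a * A.grading a') (B.odd b * b') := rfl

theorem star_tmul (a : A) (b : B) :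
    star (tmul a b) =
      tmul (star a) (star (B.even b)) + tmul (star (A.grading a)) (star (B.odd b)) := rfl

instance : NonUnitalNonAssocRing (AlgTensor A B) where
  left_distrib x y z := by simp only [mul_def, map_add]
  right_distrib x y z := by simp only [mul_def, map_add, LinearMap.add_apply]
  zero_mul x := by simp only [mul_def, map_zero, LinearMap.zero_apply]
  mul_zero x := by simp only [mul_def, map_zero]

instance : NonUnitalRing (AlgTensor A B) where
  mul_assoc x y z := by
    induction x using induction with
    | zero => simp
    | add x x' hx hx' => rw [add_mul, add_mul, add_mul, hx, hx']
    | tmul a b =>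
      induction y using induction with
      | zero => simp
      | add y y' hy hy' => rw [mul_add, add_mul, add_mul, mul_add, hy, hy']
      | tmul a' b' =>
        induction z using induction with
        | zero => simp
        | add z z' hz hz' => rw [mul_add, mul_add, mul_add, hz, hz']
        | tmul a'' b'' =>
          simp only [tmul_mul_tmul, add_mul, mul_add, map_mul, even_even_mul, odd_even_mul,
            even_odd_mul, odd_odd_mul, mul_assoc, grading_grading]
          abel

instance : StarRing (AlgTensor A B) where
  star_add x y := by simp only [star_def, map_add]
  star_involutive x := by
    induction x using induction with
    | zero => simp only [star_def, map_zero]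
    | add x y hx hy =>
      rw [star_def, star_def, map_add, map_add] at *
      rw [hx, hy]
    | tmul a b =>
      rw [star_tmul, star_def, map_add, ← star_def, ← star_def, star_tmul, star_tmul]
      simp only [even_star, odd_star, even_even, even_odd, odd_even, odd_odd, star_star, star_zero,
        tmul_zero, add_zero, zero_add, map_star, grading_grading]
      rw [← tmul_add, even_add_odd]
  star_mul x y := by
    induction x using induction with
    | zero => simp only [star_def, map_zero, zero_mul, mul_zero]
    | add x x' hx hx' =>
      have h : ∀ s t : AlgTensor A B, star (s + t) = star s + star t := fun s t => by
        simp only [star_def, map_add]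
      rw [add_mul, h, h, mul_add, hx, hx']
    | tmul a b =>
      induction y using induction with
      | zero => simp only [star_def, map_zero, zero_mul, mul_zero]
      | add y y' hy hy' =>
        have h : ∀ s t : AlgTensor A B, star (s + t) = star s + star t := fun s t => by
          simp only [star_def, map_add]
        rw [mul_add, h, h, add_mul, hy, hy']
      | tmul a' b' =>
        have h : ∀ s t : AlgTensor A B, star (s + t) = star s + star t := fun s t => by
          simp only [star_def, map_add]
        simp only [tmul_mul_tmul, h, star_tmul, add_mul, mul_add, even_even_mul, odd_even_mul,
          even_odd_mul, odd_odd_mul, star_mul, map_mul, grading_grading, even_star, odd_star,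
          even_even, even_odd, odd_even, odd_odd, star_zero, zero_mul, tmul_zero, add_zero,
          zero_add, map_star]
        abel

instance : IsScalarTower ℂ (AlgTensor A B) (AlgTensor A B) where
  smul_assoc z x y := by simp only [smul_eq_mul, mul_def, map_smul, LinearMap.smul_apply]

instance : SMulCommClass ℂ (AlgTensor A B) (AlgTensor A B) where
  smul_comm z x y := by simp only [smul_eq_mul, mul_def, map_smul]

instance : StarModule ℂ (AlgTensor A B) where
  star_smul z x := (starHom A B).map_smulₛₗ z x

end AlgTensor
end GradedCStarAlg

/-! ### The maximal C*-seminorm -/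

theorem exists_defect {A : Type u} [NonUnitalCStarAlgebra A] (a : A) (ha : ‖a‖ ≤ 1) :
    ∃ c : A, star c = c ∧ c + c - c * c = star a * a := by
  let f : ℝ → ℝ := fun t => 1 - √(1 - t)
  have hf : Continuous f := by fun_prop
  have hf0 : f 0 = 0 := by simp [f]
  have hs : IsSelfAdjoint (star a * a) := IsSelfAdjoint.star_mul_self a
  refine ⟨cfcₙ f (star a * a), IsSelfAdjoint.cfcₙ, ?_⟩
  have h1 : cfcₙ (fun t => f t + f t - f t * f t) (star a * a) =
      cfcₙ f (star a * a) + cfcₙ f (star a * a) - cfcₙ f (star a * a) * cfcₙ f (star a * a) := by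
    rw [cfcₙ_sub (fun t => f t + f t) (fun t => f t * f t) (star a * a)
      (hf.add hf).continuousOn (by simp [hf0]) (hf.mul hf).continuousOn (by simp [hf0]),
      cfcₙ_add f f (star a * a) hf.continuousOn hf0 hf.continuousOn hf0,
      cfcₙ_mul f f (star a * a) hf.continuousOn hf0 hf.continuousOn hf0]
  rw [← h1]
  conv_rhs => rw [← cfcₙ_id' ℝ (star a * a) hs]
  refine cfcₙ_congr fun t ht => ?_
  have h2 : ‖t‖ ≤ ‖star a * a‖ :=
    NonUnitalIsometricContinuousFunctionalCalculus.norm_quasispectrum_le (star a * a) ht hs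
  rw [CStarRing.norm_star_mul_self, Real.norm_eq_abs] at h2
  have h3 : t ≤ 1 := (le_abs_self t).trans (h2.trans (mul_le_one₀ ha (norm_nonneg _) ha))
  have h4 := Real.mul_self_sqrt (sub_nonneg.2 h3)
  simp only [f]
  linarith

theorem norm_le_of_star_mul_self {C : Type u} [NonUnitalCStarAlgebra C] {x y z : C}
    (h : star x * x = star y * y + star z * z) : ‖y‖ ≤ ‖x‖ := by
  let _ := CStarAlgebra.spectralOrder C
  let _ := CStarAlgebra.spectralOrderedRing C
  have h1 : star y * y ≤ star x * x := by
    rw [h]; exact le_add_of_nonneg_right (star_mul_self_nonneg z)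
  have h2 := CStarAlgebra.norm_le_norm_of_nonneg_of_le (star_mul_self_nonneg y) h1
  rw [CStarRing.norm_star_mul_self, CStarRing.norm_star_mul_self] at h2
  exact abs_le_of_sq_le_sq' (by nlinarith) (norm_nonneg _) |>.2

/-- A C*-algebra that acts on a `*`-algebra by multipliers acts by operators of norm at most
one with respect to any C*-seminorm. -/
theorem CStarSeminorm.act_le {A : Type v} [NonUnitalCStarAlgebra A] {R : Type u} [NonUnitalRing R]
    [StarRing R] [Module ℂ R] [IsScalarTower ℂ R R] [SMulCommClass ℂ R R] [StarModule ℂ R]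
    (p : CStarSeminorm R) (L : A →ₗ[ℂ] R →ₗ[ℂ] R) (hmul : ∀ a b x, L (a * b) x = L a (L b x))
    (hstar : ∀ a x y, star (L a x) * y = star x * L (star a) y) (a : A) (x : R) :
    p (L a x) ≤ ‖a‖ * p x := by
  have key : ∀ (a : A) (x : R), ‖a‖ ≤ 1 → p (L a x) ≤ p x := by
    intro a x ha
    obtain ⟨c, hc, hca⟩ := exists_defect a ha
    have h : star x * x = star (L a x) * L a x + star (x - L c x) * (x - L c x) := by
      rw [hstar, ← hmul, ← hca, star_sub, sub_mul, mul_sub, hstar, hc, map_sub (L c), ← hmul]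
      simp only [map_add, map_sub, LinearMap.add_apply, LinearMap.sub_apply, mul_add, mul_sub]
      abel
    have h' := congrArg p.ofHom h
    simp only [map_add, map_mul, map_star] at h'
    have := norm_le_of_star_mul_self h'
    have e : ∀ x, ‖p.ofHom x‖ = p x := p.norm_of
    rwa [e, e] at this
  rcases eq_or_ne a 0 with rfl | h0
  · simp [p.zero_eq]
  have hn : (‖a‖ : ℂ) ≠ 0 := by simpa using h0
  have h1 : a = (‖a‖ : ℂ) • ((‖a‖ : ℂ)⁻¹ • a) := by rw [smul_smul, mul_inv_cancel₀ hn, one_smul]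
  have h2 := key ((‖a‖ : ℂ)⁻¹ • a) x (by
    rw [norm_smul, norm_inv, Complex.norm_real, norm_norm, inv_mul_cancel₀ (by simpa using h0)])
  rw [h1, map_smul, LinearMap.smul_apply, p.smul, ← h1, Complex.norm_real, norm_norm]
  exact mul_le_mul_of_nonneg_left h2 (norm_nonneg _)

namespace GradedCStarAlg
variable {A B : GradedCStarAlg.{u} IsReal}

namespace AlgTensor

/-- Left multiplication by `a ⊗ 1`. -/
def actLeft (A B : GradedCStarAlg.{u} IsReal) : A →ₗ[ℂ] AlgTensor A B →ₗ[ℂ] AlgTensor A B :=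
  ((TensorProduct.mapBilinear (RingHom.id ℂ) A B A B).flip LinearMap.id ∘ₗ LinearMap.mul ℂ A :
    A →ₗ[ℂ] A ⊗[ℂ] B →ₗ[ℂ] A ⊗[ℂ] B)

/-- Left multiplication by `1 ⊗ b`. -/
def actRight (A B : GradedCStarAlg.{u} IsReal) : B →ₗ[ℂ] AlgTensor A B →ₗ[ℂ] AlgTensor A B :=
  (TensorProduct.mapBilinear (RingHom.id ℂ) A B A B LinearMap.id ∘ₗ LinearMap.mul ℂ B ∘ₗ B.even +
    TensorProduct.mapBilinear (RingHom.id ℂ) A B A B (A.grading : A →ₗ[ℂ] A) ∘ₗ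
      LinearMap.mul ℂ B ∘ₗ B.odd :
    B →ₗ[ℂ] A ⊗[ℂ] B →ₗ[ℂ] A ⊗[ℂ] B)

theorem actLeft_tmul (a a' : A) (b' : B) : actLeft A B a (tmul a' b') = tmul (a * a') b' := rfl

theorem actRight_tmul (b : B) (a' : A) (b' : B) : actRight A B b (tmul a' b') =
    tmul a' (B.even b * b') + tmul (A.grading a') (B.odd b * b') := rfl

theorem actLeft_le (p : CStarSeminorm (AlgTensor A B)) (a : A) (x : AlgTensor A B) :
    p (actLeft A B a x) ≤ ‖a‖ * p x := by
  refine p.act_le (actLeft A B) (fun a b x => ?_) (fun a x y => ?_) a x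
  · induction x using induction with
    | zero => simp
    | add x y hx hy => rw [map_add, map_add, map_add, hx, hy]
    | tmul a' b' => rw [actLeft_tmul, actLeft_tmul, actLeft_tmul, mul_assoc]
  · induction x using induction with
    | zero => simp
    | add x x' hx hx' => rw [map_add, star_add, star_add, add_mul, add_mul, hx, hx']
    | tmul a' b' =>
      induction y using induction with
      | zero => simp
      | add y y' hy hy' => rw [map_add, mul_add, mul_add, hy, hy']
      | tmul a'' b'' =>
        simp only [actLeft_tmul, star_tmul, tmul_mul_tmul, add_mul, star_mul, map_mul, even_star,
          odd_star, even_even, even_odd, odd_even, odd_odd, star_zero, zero_mul, tmul_zero,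
          add_zero, zero_add, map_star, mul_assoc]

theorem actRight_le (p : CStarSeminorm (AlgTensor A B)) (b : B) (x : AlgTensor A B) :
    p (actRight A B b x) ≤ ‖b‖ * p x := by
  refine p.act_le (actRight A B) (fun a b x => ?_) (fun a x y => ?_) b x
  · induction x using induction with
    | zero => simp
    | add x y hx hy => rw [map_add, map_add, map_add, hx, hy]
    | tmul a' b' =>
      have e : ∀ c d : B, B.even (c * d) = B.even c * B.even d + B.odd c * B.odd d := fun c d => by
        conv_lhs => rw [← B.even_add_odd c, add_mul, map_add, even_even_mul, even_odd_mul]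
      have o : ∀ c d : B, B.odd (c * d) = B.even c * B.odd d + B.odd c * B.even d := fun c d => by
        conv_lhs => rw [← B.even_add_odd c, add_mul, map_add, odd_even_mul, odd_odd_mul]
      simp only [actRight_tmul, map_add, e, o, add_mul, tmul_add, grading_grading, mul_assoc]
      abel
  · induction x using induction with
    | zero => simp
    | add x x' hx hx' => rw [map_add, star_add, star_add, add_mul, add_mul, hx, hx']
    | tmul a' b' =>
      induction y using induction with
      | zero => simp
      | add y y' hy hy' => rw [map_add, mul_add, mul_add, hy, hy']
      | tmul a'' b'' =>
        simp only [actRight_tmul, star_tmul, tmul_mul_tmul, add_mul, mul_add, star_add,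
          even_star, odd_star, even_even_mul, odd_even_mul, even_odd_mul, odd_odd_mul,
          even_even, even_odd, odd_even, odd_odd, star_zero, zero_mul, tmul_zero, grading_grading,
          add_zero, zero_add]
        simp only [star_mul, mul_assoc, mul_zero, star_zero, zero_mul, tmul_zero, add_zero, zero_add]
        abel

theorem le_of_even (p : CStarSeminorm (AlgTensor A B)) (a : A) (b : B) :
    p (tmul a (B.even b)) ≤ ‖a‖ * ‖B.even b‖ := by
  set c := B.even b with hc
  have hce : B.even c = c := B.even_even b
  have hco : B.odd c = 0 := B.odd_even b
  have h : star (tmul a c) * tmul a c =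
      actLeft A B (star a) (actRight A B (star c) (tmul a c)) := by
    simp only [star_tmul, hce, hco, star_zero, tmul_zero, add_zero, tmul_mul_tmul, even_star,
      odd_star, zero_mul, actRight_tmul, actLeft_tmul]
  have h1 := p.star_mul_self (tmul a c)
  rw [h] at h1
  have h2 := (actLeft_le p (star a) (actRight A B (star c) (tmul a c))).trans
    (mul_le_mul_of_nonneg_left (actRight_le p (star c) (tmul a c)) (norm_nonneg _))
  rw [h1, norm_star, norm_star, ← mul_assoc] at h2
  rcases (p.nonneg (tmul a c)).eq_or_lt with h0 | h0
  · rw [← h0]; positivity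
  · exact le_of_mul_le_mul_right h2 h0

theorem le_of_odd (p : CStarSeminorm (AlgTensor A B)) (a : A) (b : B) :
    p (tmul a (B.odd b)) ≤ ‖A.grading a‖ * ‖B.odd b‖ := by
  set c := B.odd b with hc
  have hce : B.even c = 0 := B.even_odd b
  have hco : B.odd c = c := B.odd_odd b
  have h : star (tmul a c) * tmul a c =
      actLeft A B (star (A.grading a)) (actRight A B (star c) (tmul a c)) := by
    simp only [star_tmul, hce, hco, star_zero, tmul_zero, zero_add, tmul_mul_tmul, even_star,
      odd_star, zero_mul, actRight_tmul, actLeft_tmul]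
  have h1 := p.star_mul_self (tmul a c)
  rw [h] at h1
  have h2 := (actLeft_le p (star (A.grading a)) (actRight A B (star c) (tmul a c))).trans
    (mul_le_mul_of_nonneg_left (actRight_le p (star c) (tmul a c)) (norm_nonneg _))
  rw [h1, norm_star, norm_star, ← mul_assoc] at h2
  rcases (p.nonneg (tmul a c)).eq_or_lt with h0 | h0
  · rw [← h0]; positivity
  · exact le_of_mul_le_mul_right h2 h0

/-- The C*-seminorms on the algebraic graded tensor product are uniformly bounded on every
element. -/
theorem exists_bound (x : AlgTensor A B) : ∃ C, ∀ p : CStarSeminorm (AlgTensor A B), p x ≤ C := by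
  induction x using induction with
  | zero => exact ⟨0, fun p => p.zero_eq.le⟩
  | add x y hx hy =>
    obtain ⟨C, hC⟩ := hx
    obtain ⟨D, hD⟩ := hy
    exact ⟨C + D, fun p => (p.add_le x y).trans (add_le_add (hC p) (hD p))⟩
  | tmul a b =>
    refine ⟨‖a‖ * ‖B.even b‖ + ‖A.grading a‖ * ‖B.odd b‖, fun p => ?_⟩
    rw [← B.even_add_odd b, tmul_add, B.even_add_odd b]
    exact (p.add_le _ _).trans (add_le_add (le_of_even p a b) (le_of_odd p a b))

end AlgTensor
end GradedCStarAlg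

namespace CStarSeminorm

section

variable {R : Type u} [NonUnitalRing R] [StarRing R] [Module ℂ R]
  {R' : Type v} [NonUnitalRing R'] [StarRing R'] [Module ℂ R']

/-- The pullback of a C*-seminorm along a `*`-homomorphism. -/
def comap (q : CStarSeminorm R') (φ : R →⋆ₙₐ[ℂ] R') : CStarSeminorm R where
  toFun x := q (φ x)
  add_le x y := by rw [map_add]; exact q.add_le _ _
  smul z x := by rw [map_smul]; exact q.smul _ _
  mul_le x y := by rw [map_mul]; exact q.mul_le _ _
  star_mul_self x := by rw [map_mul, map_star]; exact q.star_mul_self _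

variable (p : CStarSeminorm R) (q : CStarSeminorm R')

theorem extend_of_map {φ : R →⋆ₙₐ[ℂ] R'} (h : ∀ x, q (φ x) ≤ p x) (x : R) :
    p.extend (fun x => q.of (φ x)) (p.of x) = q.of (φ x) :=
  p.extend_of (f := fun x => q.of (φ x)) (by simp) (C := 1)
    (fun x => by rw [norm_of, one_mul]; exact h x) x

/-- A `*`-homomorphism which decreases the given C*-seminorms extends to the completions. -/
def map (φ : R →⋆ₙₐ[ℂ] R') (h : ∀ x, q (φ x) ≤ p x) : p.Completion →⋆ₙₐ[ℂ] q.Completion where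
  toFun := p.extend fun x => q.of (φ x)
  map_smul' z x := by
    change p.extend (fun x => q.of (φ x)) (z • x) = z • p.extend (fun x => q.of (φ x)) x
    induction x using induction with
    | hc =>
      exact isClosed_eq ((p.continuous_extend _).comp (p.continuous_smul' z))
        ((q.continuous_smul' z).comp (p.continuous_extend _))
    | h r => rw [← map_smul, extend_of_map p q h, extend_of_map p q h, map_smul, map_smul]
  map_zero' := by
    have := extend_of_map p q h 0
    simpa using this
  map_add' x y := by
    induction x using induction with
    | hc =>
      exact isClosed_eq ((p.continuous_extend _).comp (continuous_add_const y))
        ((p.continuous_extend _).add continuous_const)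
    | h r =>
      induction y using induction with
      | hc =>
        exact isClosed_eq ((p.continuous_extend _).comp (continuous_const_add _))
          (continuous_const.add (p.continuous_extend _))
      | h s =>
        rw [← map_add, extend_of_map p q h, extend_of_map p q h, extend_of_map p q h, map_add,
          map_add]
  map_mul' x y := by
    induction x using induction with
    | hc =>
      exact isClosed_eq ((p.continuous_extend _).comp (p.continuous_mul_right y))
        ((p.continuous_extend _).mul continuous_const)
    | h r =>
      induction y using induction with
      | hc =>
        exact isClosed_eq ((p.continuous_extend _).comp (continuous_const_mul _))
          (continuous_const.mul (p.continuous_extend _))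
      | h s =>
        rw [← of_mul, extend_of_map p q h, extend_of_map p q h, extend_of_map p q h, map_mul,
          of_mul]
  map_star' x := by
    induction x using induction with
    | hc =>
      exact isClosed_eq ((p.continuous_extend _).comp p.continuous_star')
        (q.continuous_star'.comp (p.continuous_extend _))
    | h r => rw [star_of, extend_of_map p q h, extend_of_map p q h, map_star, star_of]

theorem map_of {φ : R →⋆ₙₐ[ℂ] R'} (h : ∀ x, q (φ x) ≤ p x) (x : R) :
    p.map q φ h (p.of x) = q.of (φ x) :=
  extend_of_map p q h x

theorem continuous_map (φ : R →⋆ₙₐ[ℂ] R') (h : ∀ x, q (φ x) ≤ p x) : Continuous (p.map q φ h) :=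
  p.continuous_extend _

end

end CStarSeminorm

namespace GradedCStarAlg

/-- The grading automorphism is a graded (Real) `*`-homomorphism. -/
def gradingHom (A : GradedCStarAlg.{u} IsReal) : Hom A A where
  toHom := A.grading
  map_grading _ := rfl
  map_conj h a := (A.conj_grading h a).symm

namespace AlgTensor

variable {A B A' B' : GradedCStarAlg.{u} IsReal}

/-- The linear map underlying `f ⊗ g`. -/
def mapₗ (f : Hom A A') (g : Hom B B') : AlgTensor A B →ₗ[ℂ] AlgTensor A' B' :=
  (TensorProduct.map (f.toHom : A →ₗ[ℂ] A') (g.toHom : B →ₗ[ℂ] B') :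
    A ⊗[ℂ] B →ₗ[ℂ] A' ⊗[ℂ] B')

theorem mapₗ_tmul (f : Hom A A') (g : Hom B B') (a : A) (b : B) :
    mapₗ f g (tmul a b) = tmul (f a) (g b) := rfl

/-- The `*`-homomorphism `f ⊗ g` of algebraic graded tensor products. -/
def map (f : Hom A A') (g : Hom B B') : AlgTensor A B →⋆ₙₐ[ℂ] AlgTensor A' B' where
  toFun := mapₗ f g
  map_smul' := (mapₗ f g).map_smul
  map_zero' := (mapₗ f g).map_zero
  map_add' := (mapₗ f g).map_add
  map_mul' x y := by
    induction x using induction with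
    | zero => simp
    | add x x' hx hx' => rw [add_mul, map_add, map_add, add_mul, hx, hx']
    | tmul a b =>
      induction y using induction with
      | zero => simp
      | add y y' hy hy' => rw [mul_add, map_add, map_add, mul_add, hy, hy']
      | tmul a' b' =>
        simp only [tmul_mul_tmul, map_add, mapₗ_tmul, map_mul, Hom.map_even, Hom.map_odd,
          Hom.map_grading]
  map_star' x := by
    induction x using induction with
    | zero => simp
    | add x x' hx hx' => rw [star_add, map_add, map_add, star_add, hx, hx']
    | tmul a b =>
      simp only [star_tmul, map_add, mapₗ_tmul, map_star, Hom.map_even, Hom.map_odd,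
        Hom.map_grading]

theorem map_tmul (f : Hom A A') (g : Hom B B') (a : A) (b : B) :
    map f g (tmul a b) = tmul (f a) (g b) := rfl

variable (A B) in
/-- The antilinear map `conj ⊗ conj`. -/
def conj (h : IsReal) : AlgTensor A B →ₛₗ[starRingEnd ℂ] AlgTensor A B :=
  (TensorProduct.map (A.conjₛₗ h) (B.conjₛₗ h) : A ⊗[ℂ] B →ₛₗ[starRingEnd ℂ] A ⊗[ℂ] B)

theorem conj_tmul (h : IsReal) (a : A) (b : B) :
    conj A B h (tmul a b) = tmul (A.conj h a) (B.conj h b) := rfl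

theorem conj_mul (h : IsReal) (x y : AlgTensor A B) :
    conj A B h (x * y) = conj A B h x * conj A B h y := by
  induction x using induction with
  | zero => simp
  | add x x' hx hx' => rw [add_mul, map_add, map_add, add_mul, hx, hx']
  | tmul a b =>
    induction y using induction with
    | zero => simp
    | add y y' hy hy' => rw [mul_add, map_add, map_add, mul_add, hy, hy']
    | tmul a' b' =>
      simp only [tmul_mul_tmul, map_add, conj_tmul, GradedCStarAlg.conj_mul, conj_even, conj_odd,
        conj_grading]

theorem conj_star (h : IsReal) (x : AlgTensor A B) :
    conj A B h (star x) = star (conj A B h x) := by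
  induction x using induction with
  | zero => simp
  | add x x' hx hx' => rw [star_add, map_add, map_add, star_add, hx, hx']
  | tmul a b =>
    simp only [star_tmul, map_add, conj_tmul, GradedCStarAlg.conj_star, conj_even, conj_odd,
      conj_grading]

theorem conj_conj (h : IsReal) (x : AlgTensor A B) : conj A B h (conj A B h x) = x := by
  induction x using induction with
  | zero => simp
  | add x x' hx hx' => rw [map_add, map_add, hx, hx']
  | tmul a b => simp only [conj_tmul, GradedCStarAlg.conj_conj]

theorem map_conj (f : Hom A A') (g : Hom B B') (h : IsReal) (x : AlgTensor A B) :
    map f g (conj A B h x) = conj A' B' h (map f g x) := by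
  induction x using induction with
  | zero => simp
  | add x x' hx hx' => rw [map_add, map_add, map_add, map_add, hx, hx']
  | tmul a b => simp only [conj_tmul, map_tmul, Hom.map_conj]

theorem map_comp (f : Hom A A') (g : Hom B B') {A'' B'' : GradedCStarAlg.{u} IsReal}
    (f' : Hom A' A'') (g' : Hom B' B'') (x : AlgTensor A B) :
    map (f'.comp f) (g'.comp g) x = map f' g' (map f g x) := by
  induction x using induction with
  | zero => simp
  | add x x' hx hx' => rw [map_add, map_add, map_add, hx, hx']
  | tmul a b => rfl

theorem map_id (x : AlgTensor A B) : map (Hom.id A) (Hom.id B) x = x := by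
  induction x using induction with
  | zero => simp
  | add x x' hx hx' => rw [map_add, hx, hx']
  | tmul a b => rfl

/-- The pullback of a C*-seminorm along the antilinear map `conj ⊗ conj`. -/
def conjSeminorm (p : CStarSeminorm (AlgTensor A B)) (h : IsReal) :
    CStarSeminorm (AlgTensor A B) where
  toFun x := p (conj A B h x)
  add_le x y := by rw [_root_.map_add]; exact p.add_le _ _
  smul z x := by rw [LinearMap.map_smulₛₗ, p.smul]; simp
  mul_le x y := by rw [conj_mul]; exact p.mul_le _ _
  star_mul_self x := by rw [conj_mul, conj_star]; exact p.star_mul_self _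

instance : Nonempty (CStarSeminorm (AlgTensor A B)) :=
  ⟨{ toFun := fun _ => 0
     add_le := by simp
     smul := by simp
     mul_le := by simp
     star_mul_self := by simp }⟩

theorem bddAbove (x : AlgTensor A B) :
    BddAbove (Set.range fun p : CStarSeminorm (AlgTensor A B) => p x) := by
  obtain ⟨C, hC⟩ := exists_bound x
  exact ⟨C, by rintro _ ⟨p, rfl⟩; exact hC p⟩

variable (A B) in
/-- The maximal C*-seminorm on the algebraic graded tensor product: the supremum of all
C*-seminorms. -/
def maxSeminorm : CStarSeminorm (AlgTensor A B) where
  toFun x := ⨆ p : CStarSeminorm (AlgTensor A B), p x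
  add_le x y := ciSup_le fun p => (p.add_le x y).trans
    (add_le_add (le_ciSup (bddAbove x) p) (le_ciSup (bddAbove y) p))
  smul z x := by
    rw [Real.mul_iSup_of_nonneg (norm_nonneg z)]
    exact iSup_congr fun p => p.smul z x
  mul_le x y := ciSup_le fun p => (p.mul_le x y).trans
    (mul_le_mul (le_ciSup (bddAbove x) p) (le_ciSup (bddAbove y) p) (p.nonneg y)
      (Real.iSup_nonneg fun p => p.nonneg x))
  star_mul_self x := by
    refine le_antisymm (ciSup_le fun p => ?_) ?_
    · rw [p.star_mul_self]
      exact mul_le_mul (le_ciSup (bddAbove x) p) (le_ciSup (bddAbove x) p) (p.nonneg x)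
        (Real.iSup_nonneg fun p => p.nonneg x)
    · have h : (⨆ p : CStarSeminorm (AlgTensor A B), p x) ≤
          √(⨆ p : CStarSeminorm (AlgTensor A B), p (star x * x)) := ciSup_le fun p => by
        apply Real.le_sqrt_of_sq_le
        rw [sq, ← p.star_mul_self]
        exact le_ciSup (bddAbove (star x * x)) p
      have h0 : 0 ≤ ⨆ p : CStarSeminorm (AlgTensor A B), p x := Real.iSup_nonneg fun p => p.nonneg x
      have h1 : 0 ≤ ⨆ p : CStarSeminorm (AlgTensor A B), p (star x * x) :=
        Real.iSup_nonneg fun p => p.nonneg _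
      calc _ ≤ √(⨆ p : CStarSeminorm (AlgTensor A B), p (star x * x)) *
            √(⨆ p : CStarSeminorm (AlgTensor A B), p (star x * x)) := mul_le_mul h h h0 (by positivity)
        _ = _ := Real.mul_self_sqrt h1

theorem le_max (p : CStarSeminorm (AlgTensor A B)) (x : AlgTensor A B) : p x ≤ maxSeminorm A B x :=
  le_ciSup (bddAbove x) p

theorem max_map_le (f : Hom A A') (g : Hom B B') (x : AlgTensor A B) :
    maxSeminorm A' B' (map f g x) ≤ maxSeminorm A B x :=
  le_max ((maxSeminorm A' B').comap (map f g)) x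

theorem max_conj_le (h : IsReal) (x : AlgTensor A B) :
    maxSeminorm A B (conj A B h x) ≤ maxSeminorm A B x :=
  le_max (conjSeminorm (maxSeminorm A B) h) x

end AlgTensor

/-! ### The maximal graded tensor product -/

section

variable {A B A' B' A'' B'' : GradedCStarAlg.{u} IsReal}

/-- The `*`-homomorphism `f ⊗̂ g` of maximal graded tensor products. -/
def tensorMap (f : Hom A A') (g : Hom B B') :
    (AlgTensor.maxSeminorm A B).Completion →⋆ₙₐ[ℂ] (AlgTensor.maxSeminorm A' B').Completion :=
  (AlgTensor.maxSeminorm A B).map (AlgTensor.maxSeminorm A' B') (AlgTensor.map f g)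
    (AlgTensor.max_map_le f g)

theorem tensorMap_of (f : Hom A A') (g : Hom B B') (x : AlgTensor A B) :
    tensorMap f g ((AlgTensor.maxSeminorm A B).of x) =
      (AlgTensor.maxSeminorm A' B').of (AlgTensor.map f g x) :=
  CStarSeminorm.map_of _ _ _ _

theorem continuous_tensorMap (f : Hom A A') (g : Hom B B') : Continuous (tensorMap f g) :=
  CStarSeminorm.continuous_map _ _ _ _

theorem tensorMap_comp (f : Hom A A') (g : Hom B B') (f' : Hom A' A'') (g' : Hom B' B'')
    (x : (AlgTensor.maxSeminorm A B).Completion) :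
    tensorMap (f'.comp f) (g'.comp g) x = tensorMap f' g' (tensorMap f g x) := by
  induction x using CStarSeminorm.induction with
  | hc =>
    exact isClosed_eq (continuous_tensorMap _ _)
      ((continuous_tensorMap _ _).comp (continuous_tensorMap _ _))
  | h r => rw [tensorMap_of, tensorMap_of, tensorMap_of, AlgTensor.map_comp]

theorem tensorMap_id (x : (AlgTensor.maxSeminorm A B).Completion) :
    tensorMap (Hom.id A) (Hom.id B) x = x := by
  induction x using CStarSeminorm.induction with
  | hc => exact isClosed_eq (continuous_tensorMap _ _) continuous_id
  | h r => rw [tensorMap_of, AlgTensor.map_id]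

theorem tensorMap_grading (f : Hom A A') (g : Hom B B')
    (x : (AlgTensor.maxSeminorm A B).Completion) :
    tensorMap f g (tensorMap A.gradingHom B.gradingHom x) =
      tensorMap A'.gradingHom B'.gradingHom (tensorMap f g x) := by
  have hA : f.comp A.gradingHom = A'.gradingHom.comp f := Hom.ext' f.map_grading
  have hB : g.comp B.gradingHom = B'.gradingHom.comp g := Hom.ext' g.map_grading
  rw [← tensorMap_comp, hA, hB, tensorMap_comp]

/-- The Real structure of the maximal graded tensor product. -/
def tensorConj (A B : GradedCStarAlg.{u} IsReal) (h : IsReal) :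
    (AlgTensor.maxSeminorm A B).Completion → (AlgTensor.maxSeminorm A B).Completion :=
  (AlgTensor.maxSeminorm A B).extend fun x => (AlgTensor.maxSeminorm A B).of (AlgTensor.conj A B h x)

theorem tensorConj_of (h : IsReal) (x : AlgTensor A B) :
    tensorConj A B h ((AlgTensor.maxSeminorm A B).of x) =
      (AlgTensor.maxSeminorm A B).of (AlgTensor.conj A B h x) :=
  (AlgTensor.maxSeminorm A B).extend_of
    (f := fun x => (AlgTensor.maxSeminorm A B).of (AlgTensor.conj A B h x)) (by simp) (C := 1)
    (fun x => by rw [CStarSeminorm.norm_of, one_mul]; exact AlgTensor.max_conj_le h x) x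

theorem continuous_tensorConj (h : IsReal) : Continuous (tensorConj A B h) :=
  CStarSeminorm.continuous_extend _ _

theorem tensorMap_conj (f : Hom A A') (g : Hom B B') (h : IsReal)
    (x : (AlgTensor.maxSeminorm A B).Completion) :
    tensorMap f g (tensorConj A B h x) = tensorConj A' B' h (tensorMap f g x) := by
  induction x using CStarSeminorm.induction with
  | hc =>
    exact isClosed_eq ((continuous_tensorMap _ _).comp (continuous_tensorConj h))
      ((continuous_tensorConj h).comp (continuous_tensorMap _ _))
  | h r => rw [tensorMap_of, tensorConj_of, tensorConj_of, tensorMap_of, AlgTensor.map_conj]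

/-- The maximal graded tensor product `A ⊗̂ B`: the completion of the algebraic graded tensor
product in the maximal C*-seminorm, graded by `ε_A ⊗̂ ε_B`, with Real structure
`conj_A ⊗̂ conj_B`. -/
def tensor (A B : GradedCStarAlg.{u} IsReal) : GradedCStarAlg.{u} IsReal where
  carrier := (AlgTensor.maxSeminorm A B).Completion
  grading := tensorMap A.gradingHom B.gradingHom
  grading_grading x := by
    have hA : A.gradingHom.comp A.gradingHom = Hom.id A := Hom.ext' A.grading_grading
    have hB : B.gradingHom.comp B.gradingHom = Hom.id B := Hom.ext' B.grading_grading
    rw [← tensorMap_comp, hA, hB, tensorMap_id]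
  conj := tensorConj A B
  conj_add h x y := by
    induction x using CStarSeminorm.induction with
    | hc =>
      exact isClosed_eq ((continuous_tensorConj h).comp (continuous_add_const y))
        ((continuous_tensorConj h).add continuous_const)
    | h r =>
      induction y using CStarSeminorm.induction with
      | hc =>
        exact isClosed_eq ((continuous_tensorConj h).comp (continuous_const_add _))
          (continuous_const.add (continuous_tensorConj h))
      | h s => rw [← map_add, tensorConj_of, tensorConj_of, tensorConj_of, map_add, map_add]
  conj_smul h z x := by
    induction x using CStarSeminorm.induction with
    | hc =>
      exact isClosed_eq ((continuous_tensorConj h).comp (CStarSeminorm.continuous_smul' _ z))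
        ((CStarSeminorm.continuous_smul' _ _).comp (continuous_tensorConj h))
    | h r => rw [← map_smul, tensorConj_of, tensorConj_of, LinearMap.map_smulₛₗ, map_smul]
  conj_mul h x y := by
    induction x using CStarSeminorm.induction with
    | hc =>
      exact isClosed_eq ((continuous_tensorConj h).comp (CStarSeminorm.continuous_mul_right _ y))
        ((continuous_tensorConj h).mul continuous_const)
    | h r =>
      induction y using CStarSeminorm.induction with
      | hc =>
        exact isClosed_eq ((continuous_tensorConj h).comp (continuous_const_mul _))
          (continuous_const.mul (continuous_tensorConj h))
      | h s =>
        rw [← CStarSeminorm.of_mul, tensorConj_of, tensorConj_of, tensorConj_of,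
          AlgTensor.conj_mul, CStarSeminorm.of_mul]
  conj_star h x := by
    induction x using CStarSeminorm.induction with
    | hc =>
      exact isClosed_eq ((continuous_tensorConj h).comp (CStarSeminorm.continuous_star' _))
        ((CStarSeminorm.continuous_star' _).comp (continuous_tensorConj h))
    | h r =>
      rw [CStarSeminorm.star_of, tensorConj_of, tensorConj_of, AlgTensor.conj_star,
        CStarSeminorm.star_of]
  conj_conj h x := by
    induction x using CStarSeminorm.induction with
    | hc =>
      exact isClosed_eq ((continuous_tensorConj h).comp (continuous_tensorConj h)) continuous_id
    | h r => rw [tensorConj_of, tensorConj_of, AlgTensor.conj_conj]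
  conj_grading h x := (tensorMap_conj A.gradingHom B.gradingHom h x).symm

/-- The graded (Real) `*`-homomorphism `f ⊗̂ g : A ⊗̂ B → A' ⊗̂ B'`, given by
`a ⊗ b ↦ f a ⊗ g b`. -/
def tensorHom (f : Hom A A') (g : Hom B B') : Hom (tensor A B) (tensor A' B') where
  toHom := tensorMap f g
  map_grading x := tensorMap_grading f g x
  map_conj h x := tensorMap_conj f g h x

theorem tensorHom_id (A B : GradedCStarAlg.{u} IsReal) :
    tensorHom (Hom.id A) (Hom.id B) = Hom.id (tensor A B) := Hom.ext' tensorMap_id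

theorem tensorHom_comp (f : Hom A A') (g : Hom B B') (f' : Hom A' A'') (g' : Hom B' B'') :
    tensorHom (f'.comp f) (g'.comp g) = (tensorHom f' g').comp (tensorHom f g) :=
  Hom.ext' (tensorMap_comp f g f' g')

end
end GradedCStarAlg

/-! ### Graded (Real) Hilbert spaces and their compact operators -/

/-- A separable `ℤ/2`-graded Hilbert space, with a Real structure if `IsReal` holds. The orthogonal
decomposition into the even and the odd part is given by the isometric involution `grading` which
is `1` on the even part and `-1` on the odd part. -/
structure GradedHilbert (IsReal : Prop) : Type (u + 1) where
  carrier : Type u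
  [normed : NormedAddCommGroup carrier]
  [inner : InnerProductSpace ℂ carrier]
  [complete : CompleteSpace carrier]
  [separable : TopologicalSpace.SeparableSpace carrier]
  grading : carrier →ₗᵢ[ℂ] carrier
  grading_grading : ∀ x, grading (grading x) = x
  /-- the Real structure, an antilinear involution -/
  conj : IsReal → carrier → carrier
  conj_add : ∀ h x y, conj h (x + y) = conj h x + conj h y
  conj_smul : ∀ h (z : ℂ) x, conj h (z • x) = starRingEnd ℂ z • conj h x
  inner_conj_conj : ∀ h x y, Inner.inner ℂ (conj h x) (conj h y) = starRingEnd ℂ (Inner.inner ℂ x y)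
  conj_conj : ∀ h x, conj h (conj h x) = x
  conj_grading : ∀ h x, conj h (grading x) = grading (conj h x)

instance : CoeSort (GradedHilbert.{u} IsReal) (Type u) := ⟨GradedHilbert.carrier⟩

attribute [instance] GradedHilbert.normed GradedHilbert.inner GradedHilbert.complete
  GradedHilbert.separable

open ContinuousLinearMap in
/-- The adjoint of a compact operator is compact. -/
theorem isCompactOperator_adjoint {H H' : Type*} [NormedAddCommGroup H] [InnerProductSpace ℂ H]
    [CompleteSpace H] [NormedAddCommGroup H'] [InnerProductSpace ℂ H'] [CompleteSpace H']
    {T : H →L[ℂ] H'} (hT : IsCompactOperator T) : IsCompactOperator (adjoint T) := by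
  have hTT : IsCompactOperator (T ∘L adjoint T) := hT.comp_clm (adjoint T)
  refine (isCompactOperator_iff_isCompact_closure_image_closedBall
    ((adjoint T : H' →L[ℂ] H) : H' →ₗ[ℂ] H) one_pos).2 ?_
  rw [isCompact_iff_totallyBounded_isComplete]
  refine ⟨TotallyBounded.closure ?_, isClosed_closure.isComplete⟩
  have h1 : TotallyBounded ((T ∘L adjoint T) '' Metric.closedBall (0 : H') 1) :=
    (hTT.isCompact_closure_image_closedBall 1).totallyBounded.subset subset_closure
  rw [Metric.totallyBounded_iff]
  intro ε hε
  obtain ⟨t, ht, htf, hcov⟩ := Set.exists_subset_image_finite_and.1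
    (Metric.finite_approx_of_totallyBounded h1 (ε ^ 2 / 2) (by positivity))
  refine ⟨adjoint T '' t, htf.image _, ?_⟩
  rintro _ ⟨x, hx, rfl⟩
  obtain ⟨_, ⟨y, hy, rfl⟩, hxy⟩ := Set.mem_iUnion₂.1 (hcov ⟨x, hx, rfl⟩)
  refine Set.mem_iUnion₂.2 ⟨_, ⟨y, hy, rfl⟩, ?_⟩
  have hy1 := ht hy
  rw [mem_closedBall_zero_iff] at hx hy1
  rw [mem_ball_iff_norm] at hxy ⊢
  have h2 : ‖x - y‖ ≤ 2 := (norm_sub_le x y).trans (by linarith)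
  have h3 : ‖adjoint T x - adjoint T y‖ ^ 2 ≤ ‖T (adjoint T x) - T (adjoint T y)‖ * ‖x - y‖ := by
    have e : T (adjoint T x) - T (adjoint T y) = T (adjoint T (x - y)) := by simp
    rw [e, ← map_sub, @norm_sq_eq_re_inner ℂ, adjoint_inner_right]
    exact (Complex.re_le_norm _).trans (norm_inner_le_norm (𝕜 := ℂ) _ _)
  have h4 : ‖T (adjoint T x) - T (adjoint T y)‖ < ε ^ 2 / 2 := hxy
  refine lt_of_pow_lt_pow_left₀ 2 hε.le ?_
  change ‖adjoint T x - adjoint T y‖ ^ 2 < ε ^ 2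
  nlinarith [norm_nonneg (T (adjoint T x) - T (adjoint T y)), norm_nonneg (x - y)]

namespace GradedHilbert

open ContinuousLinearMap

/-- The Real structure as a continuous antilinear map. -/
def conjL (H : GradedHilbert.{u} IsReal) (h : IsReal) : H →L⋆[ℂ] H :=
  LinearMap.mkContinuous
    { toFun := H.conj h
      map_add' := H.conj_add h
      map_smul' := H.conj_smul h } 1 fun x => by
    rw [one_mul]
    refine le_of_eq ?_
    change ‖H.conj h x‖ = ‖x‖
    rw [@norm_eq_sqrt_re_inner ℂ, @norm_eq_sqrt_re_inner ℂ _ _ _ _ x, H.inner_conj_conj]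
    simp

theorem conjL_apply (H : GradedHilbert.{u} IsReal) (h : IsReal) (x : H) :
    H.conjL h x = H.conj h x := rfl

theorem inner_conj_left (H : GradedHilbert.{u} IsReal) (h : IsReal) (x y : H) :
    Inner.inner ℂ (H.conj h x) y = starRingEnd ℂ (Inner.inner ℂ x (H.conj h y)) := by
  rw [← H.inner_conj_conj h, H.conj_conj]

/-- The C*-algebra of compact operators. -/
def compactOps (H : Type u) [NormedAddCommGroup H] [InnerProductSpace ℂ H] [CompleteSpace H] :
    NonUnitalStarSubalgebra ℂ (H →L[ℂ] H) where
  carrier := {T | IsCompactOperator T}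
  zero_mem' := isCompactOperator_zero
  add_mem' hS hT := hS.add hT
  smul_mem' z _ hT := hT.smul z
  mul_mem' {S _} _ hT := hT.clm_comp S
  star_mem' hT := isCompactOperator_adjoint hT

theorem mem_compactOps {H : Type u} [NormedAddCommGroup H] [InnerProductSpace ℂ H]
    [CompleteSpace H] {T : H →L[ℂ] H} : T ∈ compactOps H ↔ IsCompactOperator T := Iff.rfl

instance (H : Type u) [NormedAddCommGroup H] [InnerProductSpace ℂ H] [CompleteSpace H] :
    IsClosed (compactOps H : Set (H →L[ℂ] H)) :=
  isClosed_setOfPred_isCompactOperator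

instance (H : Type u) [NormedAddCommGroup H] [InnerProductSpace ℂ H] [CompleteSpace H] :
    NonUnitalCStarAlgebra (compactOps H) := NonUnitalStarSubalgebra.nonUnitalCStarAlgebra _

section Ad

variable {H H' H'' : Type u} [NormedAddCommGroup H] [InnerProductSpace ℂ H] [CompleteSpace H]
  [NormedAddCommGroup H'] [InnerProductSpace ℂ H'] [CompleteSpace H']
  [NormedAddCommGroup H''] [InnerProductSpace ℂ H''] [CompleteSpace H'']

theorem adjoint_apply_self (V : H →ₗᵢ[ℂ] H') (x : H) :
    adjoint V.toContinuousLinearMap (V x) = x := by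
  refine ext_inner_right ℂ fun y => ?_
  rw [adjoint_inner_left]
  exact V.inner_map_map x y

/-- Conjugation `T ↦ V T V⋆` of compact operators by an isometry `V`. -/
def conjugate (V : H →ₗᵢ[ℂ] H') : compactOps H →⋆ₙₐ[ℂ] compactOps H' where
  toFun T := ⟨V.toContinuousLinearMap ∘L (T : H →L[ℂ] H) ∘L adjoint V.toContinuousLinearMap,
    (T.2.comp_clm (adjoint V.toContinuousLinearMap)).clm_comp V.toContinuousLinearMap⟩
  map_smul' z T := by ext x; simp
  map_zero' := by ext x; simp
  map_add' S T := by ext x; simp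
  map_mul' S T := by ext x; simp [adjoint_apply_self]
  map_star' T := by
    ext x
    simp [ContinuousLinearMap.star_eq_adjoint, adjoint_comp]

theorem conjugate_apply (V : H →ₗᵢ[ℂ] H') (T : compactOps H) (x : H') :
    (conjugate V T : H' →L[ℂ] H') x =
      V ((T : H →L[ℂ] H) (adjoint V.toContinuousLinearMap x)) := rfl

end Ad

/-- An even (Real) isometry of graded Hilbert spaces (not necessarily surjective). -/
@[ext]
structure Hom (H H' : GradedHilbert.{u} IsReal) : Type u where
  toIso : H →ₗᵢ[ℂ] H'
  map_grading : ∀ x, toIso (H.grading x) = H'.grading (toIso x)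
  map_conj : ∀ h x, toIso (H.conj h x) = H'.conj h (toIso x)

/-- The identity isometry. -/
def Hom.id (H : GradedHilbert.{u} IsReal) : Hom H H where
  toIso := LinearIsometry.id
  map_grading _ := rfl
  map_conj _ _ := rfl

/-- The composite `V ∘ W`. -/
def Hom.comp {H H' H'' : GradedHilbert.{u} IsReal} (V : Hom H' H'') (W : Hom H H') :
    Hom H H'' where
  toIso := V.toIso.comp W.toIso
  map_grading x := by simp [V.map_grading, W.map_grading]
  map_conj h x := by simp [V.map_conj, W.map_conj]

/-- The adjoint `V⋆` of an isometry. -/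
def Hom.adj {H H' : GradedHilbert.{u} IsReal} (V : Hom H H') : H' →L[ℂ] H :=
  adjoint V.toIso.toContinuousLinearMap

theorem Hom.adj_comp {H H' H'' : GradedHilbert.{u} IsReal} (V : Hom H' H'') (W : Hom H H')
    (x : H'') : (V.comp W).adj x = W.adj (V.adj x) := by
  have : (V.comp W).adj = W.adj ∘L V.adj :=
    adjoint_comp V.toIso.toContinuousLinearMap W.toIso.toContinuousLinearMap
  rw [this]; rfl

theorem Hom.adj_id {H : GradedHilbert.{u} IsReal} (x : H) : (Hom.id H).adj x = x :=
  adjoint_apply_self (LinearIsometry.id : H →ₗᵢ[ℂ] H) x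

theorem Hom.adj_grading {H H' : GradedHilbert.{u} IsReal} (V : Hom H H') (x : H') :
    V.adj (H'.grading x) = H.grading (V.adj x) := by
  refine ext_inner_left ℂ fun y => ?_
  have h1 : ∀ {K : GradedHilbert.{u} IsReal} (a b : K),
      Inner.inner ℂ a (K.grading b) = Inner.inner ℂ (K.grading a) b := fun {K} a b => by
    rw [← K.grading.inner_map_map, K.grading_grading]
  rw [h1, Hom.adj, adjoint_inner_right, adjoint_inner_right, h1]
  exact congrArg (fun z => Inner.inner ℂ z x) (V.map_grading y).symm

theorem Hom.adj_conj {H H' : GradedHilbert.{u} IsReal} (V : Hom H H') (h : IsReal) (x : H') :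
    V.adj (H'.conj h x) = H.conj h (V.adj x) := by
  refine ext_inner_right ℂ fun y => ?_
  rw [inner_conj_left, Hom.adj, adjoint_inner_left, adjoint_inner_left, inner_conj_left]
  exact congrArg (fun z => starRingEnd ℂ (Inner.inner ℂ x z)) (V.map_conj h y).symm

/-- The strong-`*` topology: pointwise convergence of `V` and of `V⋆`. -/
instance strongStar (H H' : GradedHilbert.{u} IsReal) : TopologicalSpace (Hom H H') :=
  TopologicalSpace.induced (fun V => ((fun x => V.toIso x), (fun x => V.adj x)))
    (inferInstance : TopologicalSpace ((H → H') × (H' → H)))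

/-- The grading is self-adjoint. -/
theorem adjoint_grading (H : GradedHilbert.{u} IsReal) (x : H) :
    adjoint H.grading.toContinuousLinearMap x = H.grading x := by
  conv_lhs => rw [← H.grading_grading x]
  exact adjoint_apply_self H.grading _

/-- The C*-algebra `𝒦(H)` of compact operators, graded by `T ↦ γ T γ` (so that `T` is even or odd
if it preserves or exchanges the even and odd parts of `H`), with Real structure
`T ↦ conj ∘ T ∘ conj`. -/
def compacts (H : GradedHilbert.{u} IsReal) : GradedCStarAlg.{u} IsReal where
  carrier := compactOps H
  grading := conjugate H.grading
  grading_grading T := by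
    ext x
    simp only [conjugate_apply, adjoint_grading, grading_grading]
  conj h T := ⟨H.conjL h ∘SL (T : H →L[ℂ] H) ∘SL H.conjL h,
    (IsCompactOperator.comp_clm (f := (T : H →L[ℂ] H)) T.2 (H.conjL h)).continuous_comp
      (H.conjL h).continuous⟩
  conj_add h S T := by
    ext x
    exact map_add (H.conjL h) _ _
  conj_smul h z T := by
    ext x
    exact (H.conjL h).map_smulₛₗ z _
  conj_mul h S T := by
    ext x
    exact congrArg (fun y => H.conj h ((S : H →L[ℂ] H) y)) (H.conj_conj h _).symm
  conj_star h T := by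
    ext x
    refine ext_inner_right ℂ fun y => ?_
    change Inner.inner ℂ (H.conj h (adjoint (T : H →L[ℂ] H) (H.conj h x))) y =
      Inner.inner ℂ (adjoint (H.conjL h ∘SL (T : H →L[ℂ] H) ∘SL H.conjL h) x) y
    rw [adjoint_inner_left, inner_conj_left, adjoint_inner_left, inner_conj_left]
    simp [conjL_apply]
  conj_conj h T := by
    ext x
    change H.conj h (H.conj h ((T : H →L[ℂ] H) (H.conj h (H.conj h x)))) = _
    rw [H.conj_conj, H.conj_conj]
  conj_grading h T := by
    ext x
    rw [conjugate_apply, adjoint_grading]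
    change H.conj h ((conjugate H.grading T : H →L[ℂ] H) (H.conj h x)) =
      H.grading (H.conj h ((T : H →L[ℂ] H) (H.conj h (H.grading x))))
    rw [conjugate_apply, adjoint_grading, H.conj_grading, H.conj_grading]

/-- The operator underlying an element of `𝒦(H)`. -/
def toOp {H : GradedHilbert.{u} IsReal} (T : compacts H) : H →L[ℂ] H :=
  ((show compactOps H from T) : H →L[ℂ] H)

theorem compacts_ext {H : GradedHilbert.{u} IsReal} {S T : compacts H}
    (h : ∀ x, toOp S x = toOp T x) : S = T :=
  Subtype.ext (ContinuousLinearMap.ext h)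

/-- The graded (Real) `*`-homomorphism `Ad V : 𝒦(H) → 𝒦(H')`, `T ↦ V T V⋆`. -/
def Ad {H H' : GradedHilbert.{u} IsReal} (V : Hom H H') :
    GradedCStarAlg.Hom (compacts H) (compacts H') where
  toHom := conjugate V.toIso
  map_grading T := by
    refine compacts_ext fun x => ?_
    change V.toIso (H.grading (toOp T (adjoint H.grading.toContinuousLinearMap
      (V.adj x)))) = H'.grading (V.toIso (toOp T (V.adj
        (adjoint H'.grading.toContinuousLinearMap x))))
    rw [adjoint_grading, adjoint_grading, V.map_grading, V.adj_grading]
  map_conj h T := by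
    refine compacts_ext fun x => ?_
    change V.toIso (H.conj h (toOp T (H.conj h (V.adj x)))) =
      H'.conj h (V.toIso (toOp T (V.adj (H'.conj h x))))
    rw [V.map_conj, V.adj_conj]

theorem Ad_apply {H H' : GradedHilbert.{u} IsReal} (V : Hom H H') (T : compacts H) (x : H') :
    toOp (Ad V T) x = V.toIso (toOp T (V.adj x)) := rfl

theorem Ad_id (H : GradedHilbert.{u} IsReal) : Ad (Hom.id H) = GradedCStarAlg.Hom.id _ := by
  refine GradedCStarAlg.Hom.ext' fun T => compacts_ext fun x => ?_
  rw [Ad_apply, Hom.adj_id]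
  rfl

theorem Ad_comp {H H' H'' : GradedHilbert.{u} IsReal} (V : Hom H' H'') (W : Hom H H') :
    Ad (V.comp W) = (Ad V).comp (Ad W) := by
  refine GradedCStarAlg.Hom.ext' fun T => compacts_ext fun x => ?_
  rw [Ad_apply, Hom.adj_comp]
  rfl

end GradedHilbert


open CategoryTheory

/-! ### The graded Real C*-algebra `𝒮` -/

/-- Pulling back a function on the real line along `x ↦ -x`. -/
def reflect : ZeroAtInftyContinuousMap ℝ ℂ →⋆ₙₐ[ℂ] ZeroAtInftyContinuousMap ℝ ℂ where
  toFun f := f.comp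
    ⟨⟨fun x => -x, continuous_neg⟩, (Homeomorph.neg ℝ).isClosedEmbedding.tendsto_cocompact⟩
  map_smul' _ _ := rfl
  map_zero' := rfl
  map_add' _ _ := rfl
  map_mul' _ _ := rfl
  map_star' _ := rfl

theorem reflect_apply (f : ZeroAtInftyContinuousMap ℝ ℂ) (x : ℝ) : reflect f x = f (-x) := rfl

/-- The C*-algebra `𝒮 = C₀(ℝ)` of continuous functions on the real line which vanish at infinity,
graded by even and odd functions, with pointwise complex conjugation as Real structure. -/
def S (IsReal : Prop) : GradedCStarAlg.{0} IsReal where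
  carrier := ZeroAtInftyContinuousMap ℝ ℂ
  grading := reflect
  grading_grading f := by
    ext x
    rw [reflect_apply, reflect_apply, neg_neg]
  conj _ f := star f
  conj_add _ f g := star_add f g
  conj_smul _ z f := star_smul z f
  conj_mul _ f g := by rw [star_mul, mul_comm]
  conj_star _ f := rfl
  conj_conj _ f := star_star f
  conj_grading _ f := rfl

/-! ### k-ification -/

/-- The k-ification of a topology `t`: the finest topology for which all `t`-continuous maps from
compact Hausdorff spaces are continuous. -/
abbrev kify {X : Type v} (t : TopologicalSpace X) : TopologicalSpace X :=
  @TopologicalSpace.compactlyGenerated.{u} X t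

theorem continuous_kify_of_probe {X : Type v} {t : TopologicalSpace X} (K : CompHaus.{u})
    {f : K → X} (hf : @Continuous _ _ _ t f) : @Continuous _ _ _ (kify.{u} t) f := by
  let _ := t
  let F : (Σ (i : (S : CompHaus.{u}) × C(S, X)), i.fst) → X := fun ⟨⟨_, i⟩, s⟩ ↦ i s
  have h1 : @Continuous _ _ _ (kify.{u} t) F := continuous_coinduced_rng
  have h2 : Continuous fun k : K =>
      (⟨⟨K, ⟨f, hf⟩⟩, k⟩ : Σ (i : (S : CompHaus.{u}) × C(S, X)), i.fst) :=
    continuous_sigmaMk (σ := fun i : (S : CompHaus.{u}) × C(S, X) => i.fst)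
      (i := ⟨K, ⟨f, hf⟩⟩)
  exact @Continuous.comp K _ X _ _ (kify.{u} t) _ F h1 h2

theorem continuous_of_probes {X : Type v} {t : TopologicalSpace X} {Y : Type w}
    {t' : TopologicalSpace Y} {f : X → Y}
    (h : ∀ (K : CompHaus.{u}) (g : K → X), @Continuous _ _ _ t g → Continuous (f ∘ g)) :
    @Continuous _ _ (kify.{u} t) t' f :=
  letI := t
  continuous_from_compactlyGenerated f fun K g => h K g g.2

theorem continuous_kify_id {X : Type v} (t : TopologicalSpace X) :
    @Continuous _ _ (kify.{u} t) t (fun x => x) :=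
  continuous_of_probes fun _ _ hg => hg

theorem kify_compactlyGenerated {X : Type v} (t : TopologicalSpace X) :
    @UCompactlyGeneratedSpace.{u} X (kify.{u} t) := by
  refine @UCompactlyGeneratedSpace.mk X (kify.{u} t) ?_
  rw [← continuous_id_iff_le]
  refine continuous_of_probes fun K g hg => ?_
  exact continuous_kify_of_probe K (continuous_kify_of_probe K hg)

/-- A continuous map stays continuous after k-ification. -/
theorem continuous_kify_kify {X : Type v} {t : TopologicalSpace X} {Y : Type w}
    {t' : TopologicalSpace Y} {f : X → Y} (h : Continuous f) :
    @Continuous _ _ (kify.{u} t) (kify.{u} t') f :=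
  continuous_of_probes fun K _ hg => continuous_kify_of_probe K (h.comp hg)

/-! ### Topologically enriched categories -/

/-- A category enriched over compactly generated spaces: the morphism sets carry compactly
generated topologies for which composition is continuous. The source of the composition map is the
product of compactly generated spaces, i.e. the k-ification of the product topology. -/
class TopEnriched (C : Type v) [Category.{u} C] where
  homTopology : ∀ X Y : C, TopologicalSpace (X ⟶ Y)
  compactlyGenerated : ∀ X Y : C,
    @UCompactlyGeneratedSpace.{u} (X ⟶ Y) (homTopology X Y)
  continuous_comp : ∀ X Y Z : C,
    @Continuous ((X ⟶ Y) × (Y ⟶ Z)) (X ⟶ Z)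
      (kify.{u} (@instTopologicalSpaceProd _ _ (homTopology X Y) (homTopology Y Z)))
      (homTopology X Z) (fun f => f.1 ≫ f.2)

/-- The k-ifications of topologies on the morphism sets make a category topologically enriched if
composition is continuous on compact Hausdorff spaces. -/
@[reducible]
def TopEnriched.ofProbes (C : Type v) [Category.{u} C]
    (t : ∀ X Y : C, TopologicalSpace (X ⟶ Y))
    (h : ∀ (X Y Z : C) (K : CompHaus.{u}) (f : K → (X ⟶ Y)) (g : K → (Y ⟶ Z)),
      Continuous f → Continuous g → Continuous fun k => f k ≫ g k) : TopEnriched C where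
  homTopology X Y := kify.{u} (t X Y)
  compactlyGenerated X Y := kify_compactlyGenerated _
  continuous_comp X Y Z := continuous_of_probes fun K p hp => by
    refine continuous_kify_of_probe K (h X Y Z K (fun k => (p k).1) (fun k => (p k).2) ?_ ?_)
    · exact @Continuous.comp _ _ _ _ (kify.{u} (t X Y)) (t X Y) _ _ (continuous_kify_id _)
        (@Continuous.comp _ _ _ _ (@instTopologicalSpaceProd _ _ (kify.{u} (t X Y))
          (kify.{u} (t Y Z))) (kify.{u} (t X Y)) _ _
          (@continuous_fst _ _ (kify.{u} (t X Y)) (kify.{u} (t Y Z))) hp)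
    · exact @Continuous.comp _ _ _ _ (kify.{u} (t Y Z)) (t Y Z) _ _ (continuous_kify_id _)
        (@Continuous.comp _ _ _ _ (@instTopologicalSpaceProd _ _ (kify.{u} (t X Y))
          (kify.{u} (t Y Z))) (kify.{u} (t Y Z)) _ _
          (@continuous_snd _ _ (kify.{u} (t X Y)) (kify.{u} (t Y Z))) hp)

/-- A functor between topologically enriched categories is topologically enriched if it is
continuous on the spaces of morphisms. -/
def IsTopEnrichedFunctor {C : Type v} [Category.{u} C] [TopEnriched C] {D : Type w}
    [Category.{u} D] [TopEnriched D] (F : C ⥤ D) : Prop :=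
  ∀ X Y : C, @Continuous (X ⟶ Y) (F.obj X ⟶ F.obj Y) (TopEnriched.homTopology X Y)
    (TopEnriched.homTopology (F.obj X) (F.obj Y)) (fun f => F.map f)

theorem TopEnriched.continuous_comp_of_probe {C : Type v} [Category.{u} C] [TopEnriched C]
    {X Y Z : C} {K : CompHaus.{u}} {f : K → (X ⟶ Y)} {g : K → (Y ⟶ Z)}
    (hf : @Continuous _ _ _ (TopEnriched.homTopology X Y) f)
    (hg : @Continuous _ _ _ (TopEnriched.homTopology Y Z) g) :
    @Continuous _ _ _ (TopEnriched.homTopology X Z) fun k => f k ≫ g k :=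
  @Continuous.comp _ _ _ _ (kify.{u} (@instTopologicalSpaceProd _ _
    (TopEnriched.homTopology X Y) (TopEnriched.homTopology Y Z)))
    (TopEnriched.homTopology X Z) _ _ (TopEnriched.continuous_comp X Y Z)
    (continuous_kify_of_probe K (@Continuous.prodMk _ _ _ (TopEnriched.homTopology X Y)
      (TopEnriched.homTopology Y Z) _ _ _ hf hg))

/-- The product of topologically enriched categories; the morphism spaces are the products, in
compactly generated spaces, of the morphism spaces of the factors. -/
instance TopEnriched.prod (C : Type v) [Category.{u} C] [TopEnriched C] (D : Type w)
    [Category.{u} D] [TopEnriched D] : TopEnriched (C × D) :=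
  TopEnriched.ofProbes (C × D)
    (fun X Y => @instTopologicalSpaceProd (X.1 ⟶ Y.1) (X.2 ⟶ Y.2)
      (TopEnriched.homTopology X.1 Y.1) (TopEnriched.homTopology X.2 Y.2))
    (fun X Y Z K f g hf hg => by
      refine @Continuous.prodMk _ _ _ (TopEnriched.homTopology X.1 Z.1)
        (TopEnriched.homTopology X.2 Z.2) _ _ _ ?_ ?_
      · exact TopEnriched.continuous_comp_of_probe
          (@Continuous.comp _ _ _ _ (_) (_) _ _ (@continuous_fst _ _ (_) (_)) hf)
          (@Continuous.comp _ _ _ _ (_) (_) _ _ (@continuous_fst _ _ (_) (_)) hg)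
      · exact TopEnriched.continuous_comp_of_probe
          (@Continuous.comp _ _ _ _ (_) (_) _ _ (@continuous_snd _ _ (_) (_)) hf)
          (@Continuous.comp _ _ _ _ (_) (_) _ _ (@continuous_snd _ _ (_) (_)) hg))

/-! ### The topologically enriched category of graded C*-algebras -/

instance : Category.{u} (GradedCStarAlg.{u} IsReal) where
  Hom A B := GradedCStarAlg.Hom A B
  id A := GradedCStarAlg.Hom.id A
  comp f g := g.comp f

namespace GradedCStarAlg

theorem Hom.norm_apply_le {A : GradedCStarAlg.{u} IsReal} {B : GradedCStarAlg.{v} IsReal}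
    (f : Hom A B) (a : A) : ‖f a‖ ≤ ‖a‖ :=
  NonUnitalStarAlgHom.norm_apply_le f.toHom a

theorem continuous_pointNorm_iff {X : Type w} [TopologicalSpace X] {A : GradedCStarAlg.{u} IsReal}
    {B : GradedCStarAlg.{v} IsReal} {F : X → Hom A B} :
    Continuous F ↔ ∀ a, Continuous fun x => F x a := by
  rw [continuous_induced_rng, continuous_pi_iff]
  rfl

theorem continuous_apply_apply {X : Type w} [TopologicalSpace X] {A : GradedCStarAlg.{u} IsReal}
    {B : GradedCStarAlg.{v} IsReal} {F : X → Hom A B} (hF : Continuous F) {a : X → A}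
    (ha : Continuous a) : Continuous fun x => F x (a x) := by
  rw [continuous_iff_continuousAt]
  intro x
  have h1 : Filter.Tendsto (fun y => F y (a x)) (nhds x) (nhds (F x (a x))) :=
    (continuous_pointNorm_iff.1 hF (a x)).continuousAt
  have h2 : Filter.Tendsto (fun y => F y (a y - a x)) (nhds x) (nhds 0) := by
    refine squeeze_zero_norm (fun y => (F y).norm_apply_le _) ?_
    have := (ha.sub (continuous_const (y := a x))).norm.continuousAt (x := x)
    simpa [ContinuousAt] using this
  have h3 := h1.add h2
  rw [add_zero] at h3
  refine h3.congr fun y => ?_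
  rw [← map_add, add_sub_cancel]

theorem continuous_hom_comp {X : Type*} [TopologicalSpace X] {A : GradedCStarAlg.{u} IsReal}
    {B : GradedCStarAlg.{v} IsReal} {C : GradedCStarAlg.{w} IsReal} {F : X → Hom A B}
    (hF : Continuous F) {G : X → Hom B C} (hG : Continuous G) :
    Continuous fun x => (G x).comp (F x) :=
  continuous_pointNorm_iff.2 fun a => continuous_apply_apply hG (continuous_pointNorm_iff.1 hF a)

end GradedCStarAlg

/-- The morphism spaces of graded C*-algebras carry the k-ification of the point-norm topology. -/
instance : TopEnriched (GradedCStarAlg.{u} IsReal) :=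
  TopEnriched.ofProbes _ (fun A B => GradedCStarAlg.pointNorm A B)
    fun _ _ _ _ _ _ hf hg => GradedCStarAlg.continuous_hom_comp hf hg

/-! ### The topologically enriched category of graded Hilbert spaces -/

instance : Category.{u} (GradedHilbert.{u} IsReal) where
  Hom H H' := GradedHilbert.Hom H H'
  id H := GradedHilbert.Hom.id H
  comp V W := W.comp V

theorem GradedHilbert.continuous_strongStar_iff {X : Type w} [TopologicalSpace X]
    {H H' : GradedHilbert.{u} IsReal} {V : X → Hom H H'} :
    Continuous V ↔ (∀ x, Continuous fun t => (V t).toIso x) ∧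
      ∀ x, Continuous fun t => (V t).adj x := by
  rw [continuous_induced_rng, ← continuous_pi_iff, ← continuous_pi_iff]
  exact continuous_prodMk

theorem GradedHilbert.continuous_hom_comp {X : Type*} [TopologicalSpace X]
    {H H' H'' : GradedHilbert.{u} IsReal} {V : X → Hom H H'} (hV : Continuous V)
    {W : X → Hom H' H''} (hW : Continuous W) : Continuous fun x => (W x).comp (V x) := by
  have key : ∀ {K L : GradedHilbert.{u} IsReal} {F : X → K → L} {a : X → K},
      (∀ x, ∀ k k', ‖F x k - F x k'‖ ≤ ‖k - k'‖) → (∀ k, Continuous fun x => F x k) →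
      Continuous a → Continuous fun x => F x (a x) := by
    intro K L F a h1 h2 ha
    rw [continuous_iff_continuousAt]
    intro x
    have h3 : Filter.Tendsto (fun y => F y (a y) - F y (a x)) (nhds x) (nhds 0) := by
      refine squeeze_zero_norm (fun y => h1 y _ _) ?_
      have := (ha.sub (continuous_const (y := a x))).norm.continuousAt (x := x)
      simpa [ContinuousAt] using this
    have h4 := h3.add ((h2 (a x)).continuousAt (x := x)).tendsto
    simpa [ContinuousAt] using h4
  have hadj : ∀ {K L : GradedHilbert.{u} IsReal} (U : Hom K L) (k k' : L),
      ‖U.adj k - U.adj k'‖ ≤ ‖k - k'‖ := by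
    intro K L U k k'
    rw [← map_sub]
    refine (ContinuousLinearMap.le_opNorm _ _).trans ?_
    refine mul_le_of_le_one_left (norm_nonneg _) ?_
    refine (LinearIsometryEquiv.norm_map ContinuousLinearMap.adjoint _).le.trans ?_
    exact U.toIso.norm_toContinuousLinearMap_le
  rw [continuous_strongStar_iff] at *
  refine ⟨fun x => ?_, fun x => ?_⟩
  · exact key (F := fun y => (W y).toIso) (a := fun y => (V y).toIso x)
      (fun y k k' => by rw [← map_sub, LinearIsometry.norm_map]) hW.1 (hV.1 x)
  · simp only [Hom.adj_comp]
    exact key (F := fun y => (V y).adj) (a := fun y => (W y).adj x)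
      (fun y k k' => hadj _ _ _) hV.2 (hW.2 x)

/-- The morphism spaces of graded Hilbert spaces carry the k-ification of the strong-`*`
topology. -/
instance : TopEnriched (GradedHilbert.{u} IsReal) :=
  TopEnriched.ofProbes _ (fun H H' => GradedHilbert.strongStar H H')
    fun _ _ _ _ _ _ hf hg => GradedHilbert.continuous_hom_comp hf hg

/-! ### The topologically enriched category of pointed compactly generated spaces -/

/-- A pointed compactly generated space. -/
structure PointedCG : Type (u + 1) where
  carrier : Type u
  [topology : TopologicalSpace carrier]
  [compactlyGenerated : UCompactlyGeneratedSpace.{u} carrier]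
  point : carrier

namespace PointedCG

instance : CoeSort PointedCG.{u} (Type u) := ⟨PointedCG.carrier⟩

attribute [instance] PointedCG.topology PointedCG.compactlyGenerated

/-- A based continuous map. -/
@[ext]
structure Hom (X Y : PointedCG.{u}) : Type u where
  toMap : C(X, Y)
  map_point : toMap X.point = Y.point

instance : Category.{u} PointedCG.{u} where
  Hom X Y := Hom X Y
  id X := ⟨ContinuousMap.id X, rfl⟩
  comp f g := ⟨g.toMap.comp f.toMap, by
    rw [ContinuousMap.comp_apply, f.map_point, g.map_point]⟩

/-- The compact-open topology on the set of based maps between compactly generated spaces: it is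
generated by the sets of all `f` such that `f ∘ a` takes values in `U`, where `a : K → X` is a
continuous map from a compact Hausdorff space and `U` is an open subset of `Y`. -/
@[reducible]
def compactOpen (X Y : PointedCG.{u}) : TopologicalSpace (Hom X Y) :=
  TopologicalSpace.generateFrom
    {s | ∃ (K : CompHaus.{u}) (a : C(K, X)) (U : Set Y), IsOpen U ∧
      s = {f | ∀ k, f.toMap (a k) ∈ U}}

theorem continuous_uncurry_of_compact {X : Type u} {L : Type v} {Y : Type w} [TopologicalSpace X]
    [TopologicalSpace L] [CompactSpace L] [T2Space L] [TopologicalSpace Y] {G : X → C(L, Y)}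
    (hG : Continuous G) : Continuous fun p : X × L => G p.1 p.2 :=
  ContinuousMap.continuous_uncurry_of_continuous ⟨G, hG⟩

/-- A map `K → Hom X Y` from a compact Hausdorff space is continuous if and only if the
associated maps `K × L → Y` are continuous for all compact Hausdorff spaces `L` over `X`. -/
theorem continuous_compactOpen_iff {X Y : PointedCG.{u}} (K : CompHaus.{u}) {F : K → Hom X Y} :
    @Continuous _ _ _ (compactOpen X Y) F ↔
      ∀ (L : CompHaus.{u}) (a : C(L, X)), Continuous fun p : K × L => (F p.1).toMap (a p.2) := by
  constructor
  · intro hF L a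
    let G : K → C(L, Y) := fun k => (F k).toMap.comp a
    have hG : Continuous G := by
      rw [ContinuousMap.continuous_compactOpen]
      intro M hM U hU
      have : CompactSpace M := isCompact_iff_compactSpace.1 hM
      let M' : CompHaus.{u} := CompHaus.of M
      let b : C(M', X) := a.comp ⟨Subtype.val, continuous_subtype_val⟩
      have h1 : @IsOpen _ (compactOpen X Y) {f : Hom X Y | ∀ k, f.toMap (b k) ∈ U} :=
        TopologicalSpace.isOpen_generateFrom_of_mem ⟨M', b, U, hU, rfl⟩
      have h2 := @IsOpen.preimage _ _ _ (compactOpen X Y) F hF _ h1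
      convert h2 using 1
      ext k
      exact ⟨fun h m => h m.2, fun h m hm => h ⟨m, hm⟩⟩
    exact continuous_uncurry_of_compact hG
  · intro h
    refine continuous_generateFrom_iff.2 ?_
    rintro _ ⟨L, a, U, hU, rfl⟩
    have h1 := (ContinuousMap.curry ⟨_, h L a⟩).continuous
    have h2 := ContinuousMap.isOpen_setOfPred_mapsTo (X := L) (Y := Y) isCompact_univ hU
    have h3 := h2.preimage h1
    convert h3 using 1
    ext k
    exact ⟨fun h l _ => h l, fun h l => h (Set.mem_univ l)⟩

theorem continuous_comp_of_probe (X Y Z : PointedCG.{u}) (K : CompHaus.{u}) (f : K → (X ⟶ Y))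
    (g : K → (Y ⟶ Z)) (hf : @Continuous _ _ _ (compactOpen X Y) f)
    (hg : @Continuous _ _ _ (compactOpen Y Z) g) :
    @Continuous _ _ _ (compactOpen X Z) fun k => f k ≫ g k := by
  rw [continuous_compactOpen_iff] at *
  intro L a
  have h1 := hg (CompHaus.of (K × L)) ⟨_, hf L a⟩
  exact h1.comp (continuous_fst.prodMk continuous_id)

end PointedCG

/-- The morphism spaces of pointed compactly generated spaces carry the k-ification of the
compact-open topology. -/
instance : TopEnriched PointedCG.{u} :=
  TopEnriched.ofProbes _ PointedCG.compactOpen PointedCG.continuous_comp_of_probe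

/-! ### The spectral K-theory functor -/

open GradedCStarAlg GradedHilbert

/-- The k-ification `k𝕂(A, H)` of the spectral K-theory space `𝕂(A, H) = Hom(𝒮, A ⊗̂ 𝒦(H))`, with
the zero homomorphism as base point. -/
def kSpectralKSpace (A : GradedCStarAlg.{u} IsReal) (H : GradedHilbert.{u} IsReal) :
    PointedCG.{u} where
  carrier := GradedCStarAlg.Hom (S IsReal) (tensor A (compacts H))
  topology := kify.{u} (pointNorm (S IsReal) (tensor A (compacts H)))
  compactlyGenerated := kify_compactlyGenerated _
  point := 0

/-- The functor `k𝕂`. A pair of a graded homomorphism `φ : A → B` and an even isometry `V : H → H'`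
induces the map `k𝕂(A, H) → k𝕂(B, H')`, `ψ ↦ (φ ⊗̂ Ad V) ∘ ψ`. -/
def kSpectralK (IsReal : Prop) :
    GradedCStarAlg.{u} IsReal × GradedHilbert.{u} IsReal ⥤ PointedCG.{u} where
  obj P := kSpectralKSpace P.1 P.2
  map {P Q} f :=
    { toMap :=
        { toFun := fun ψ => (tensorHom f.1 (Ad f.2)).comp ψ
          continuous_toFun := continuous_kify_kify
            (continuous_hom_comp continuous_id continuous_const) }
      map_point := GradedCStarAlg.Hom.ext' fun s => map_zero (tensorHom f.1 (Ad f.2)).toHom }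
  map_id P := PointedCG.Hom.ext (ContinuousMap.ext fun ψ => by
    change (tensorHom (GradedCStarAlg.Hom.id P.1) (Ad (GradedHilbert.Hom.id P.2))).comp ψ = ψ
    rw [Ad_id, tensorHom_id]
    rfl)
  map_comp {P Q R} f g := PointedCG.Hom.ext (ContinuousMap.ext fun ψ => by
    change (tensorHom (GradedCStarAlg.Hom.comp g.1 f.1)
      (Ad (GradedHilbert.Hom.comp g.2 f.2))).comp ψ =
        (tensorHom g.1 (Ad g.2)).comp ((tensorHom f.1 (Ad f.2)).comp ψ)
    rw [Ad_comp, tensorHom_comp]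
    rfl)

end SpectralKTheory

end

namespace SpectralKTheory

/-! K-ification reduces the theorem to a statement about families over compact Hausdorff spaces.
Continuity out of a k-ification may be tested along continuous maps from compact Hausdorff spaces
`K`, and a continuous map from such a `K` stays continuous when its target is k-ified. By currying,
a family over `K` is continuous into the compact-open topology as soon as, for every compact
Hausdorff `L` mapping to the source space, the uncurried map on `K × L` is continuous
(`continuous_compactOpen_iff`). Since `K × L` is again compact Hausdorff, the k-ification of its
target disappears as well. What remains is the joint continuity, for plain point-norm topologies, of
`(k, l) ↦ (φ_k ⊗̂ Ad V_k) ∘ ψ_l`. The topologies see only the underlying maps, so the Real and the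
complex version are proved together.

This joint continuity rests on equicontinuity: `*`-homomorphisms and isometries are contractions, so
pointwise convergence is automatically uniform on compact sets and passes from dense subsets to
their closures.

Composition of homomorphisms is jointly continuous in the point-norm topology for this reason
(`continuous_hom_comp`).

The map `f ⊗̂ g` depends continuously on `f` and `g` (`continuous_tensorHom`): on an elementary
tensor its value is `f a ⊗ g b`, and `⊗` is a bounded bilinear map into the completion. Sums follow,
and the density of the algebraic tensor product together with contractivity gives the rest.

The map `Ad V` depends continuously on `V` (`continuous_Ad`): a compact operator `T` sends the unit
ball to a totally bounded set, on which strong convergence of isometries is uniform. Hence `V T` is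
norm continuous in `V`; so is `T V⋆ = (V T⋆)⋆`, since `T⋆` is compact too, and the two combine to `V
T V⋆`. -/

/-! ### Continuous maps into k-ifications -/

theorem continuous_of_kify {X : Type v} {t : TopologicalSpace X} {K : Type*} [TopologicalSpace K]
    {g : K → X} (hg : @Continuous _ _ _ (kify.{u} t) g) : Continuous g :=
  @Continuous.comp _ _ _ _ (kify.{u} t) t _ _ (continuous_kify_id.{u} t) hg

/-- The topology here is the ordinary product of two k-ifications: testing on compact Hausdorff
spaces has already removed the outer k-ification of `×_CG`, and projecting and then coarsening
removes the inner one. The twin lemma treats the other factor. -/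
theorem continuous_fst_of_kify {X : Type v} {Y : Type w} {t : TopologicalSpace X}
    {t' : TopologicalSpace Y} {K : Type*} [TopologicalSpace K] {g : K → X × Y}
    (hg : @Continuous _ _ _ (@instTopologicalSpaceProd _ _ (kify.{u} t) (kify.{u} t')) g) :
    Continuous fun k => (g k).1 :=
  continuous_of_kify.{u}
    (@Continuous.comp _ _ _ _ (@instTopologicalSpaceProd _ _ (kify.{u} t) (kify.{u} t'))
      (kify.{u} t) _ _ (@continuous_fst _ _ (kify.{u} t) (kify.{u} t')) hg)

theorem continuous_snd_of_kify {X : Type v} {Y : Type w} {t : TopologicalSpace X}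
    {t' : TopologicalSpace Y} {K : Type*} [TopologicalSpace K] {g : K → X × Y}
    (hg : @Continuous _ _ _ (@instTopologicalSpaceProd _ _ (kify.{u} t) (kify.{u} t')) g) :
    Continuous fun k => (g k).2 :=
  continuous_of_kify.{u}
    (@Continuous.comp _ _ _ _ (@instTopologicalSpaceProd _ _ (kify.{u} t) (kify.{u} t'))
      (kify.{u} t') _ _ (@continuous_snd _ _ (kify.{u} t) (kify.{u} t')) hg)

/-! ### Compact operators and conjugation by isometries -/

variable {IsReal : Prop}

open ContinuousLinearMap Topology

/-- A strongly continuous family of isometries, composed with a compact operator, is continuous in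
norm. -/
theorem continuous_isometry_comp_compact {X H K L : Type*} [TopologicalSpace X]
    [NormedAddCommGroup H] [NormedSpace ℂ H] [NormedAddCommGroup K] [NormedSpace ℂ K]
    [NormedAddCommGroup L] [NormedSpace ℂ L] {V : X → K →ₗᵢ[ℂ] L}
    (hV : ∀ y, Continuous fun x => V x y) {T : H →L[ℂ] K} (hT : IsCompactOperator T) :
    Continuous fun x => (V x).toContinuousLinearMap ∘L T := by
  rw [continuous_iff_continuousAt]
  intro x₀
  rw [ContinuousAt, Metric.tendsto_nhds]
  intro ε hε
  -- Compactness of `T` enters only here: a finite net of the image of the unit ball turns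
  -- convergence at each vector into uniform convergence on that image.
  have hb : TotallyBounded (T '' Metric.closedBall (0 : H) 1) :=
    (hT.isCompact_closure_image_closedBall 1).totallyBounded.subset subset_closure
  -- The triangle inequality below has three terms. Taking `ε / 4` for each leaves a margin, needed
  -- because a bound on unit vectors controls the operator norm only by `≤`, while a strict
  -- inequality is the goal.
  obtain ⟨t, ht, hcov⟩ := Metric.totallyBounded_iff.1 hb (ε / 4) (by positivity)
  have hev : ∀ᶠ x in 𝓝 x₀, ∀ y ∈ t, dist (V x y) (V x₀ y) < ε / 4 :=
    (Filter.eventually_all_finite ht).2 fun y _ =>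
      Metric.tendsto_nhds.1 (hV y).continuousAt (ε / 4) (by positivity)
  filter_upwards [hev] with x hx
  rw [dist_eq_norm]
  refine lt_of_le_of_lt (ContinuousLinearMap.opNorm_le_of_unit_norm (C := 3 * (ε / 4))
    (by positivity) fun u hu => ?_) (by linarith)
  obtain ⟨y, hy, huy⟩ := Set.mem_iUnion₂.1
    (hcov ⟨u, by rw [mem_closedBall_zero_iff, hu], rfl⟩)
  rw [Metric.mem_ball] at huy
  -- Replacing `T u` by the net point `y` costs the same for every `x`, because all `V x` are
  -- isometries; only the middle term, between `V x y` and `V x₀ y`, depends on `x` being close to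
  -- `x₀`.
  have h1 : dist (V x (T u)) (V x y) < ε / 4 := by rwa [(V x).dist_map]
  have h2 : dist (V x₀ y) (V x₀ (T u)) < ε / 4 := by rwa [(V x₀).dist_map, dist_comm]
  have h3 := dist_triangle4 (V x (T u)) (V x y) (V x₀ y) (V x₀ (T u))
  have h4 := hx y hy
  change ‖V x (T u) - V x₀ (T u)‖ ≤ _
  rw [← dist_eq_norm]
  linarith

namespace GradedHilbert

/-- If `V` varies continuously in the strong-`*` topology, then `Ad V` varies continuously in the
point-norm topology. -/
theorem continuous_Ad {X : Type*} [TopologicalSpace X] {H H' : GradedHilbert.{u} IsReal}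
    {V : X → Hom H H'} (hV : Continuous V) : Continuous fun x => Ad (V x) := by
  rw [GradedCStarAlg.continuous_pointNorm_iff]
  intro T
  have hs := (continuous_strongStar_iff.1 hV).1
  have hT : IsCompactOperator (toOp T) := T.2
  have h1 := continuous_isometry_comp_compact hs hT
  -- The family `V T⋆` is norm continuous for the same reason as `V T`, since `T⋆` is compact, and
  -- taking adjoints is isometric in the operator norm. This handles `T V⋆ = (V T⋆)⋆`.
  have h2 := (LinearIsometryEquiv.continuous
    (adjoint : (H →L[ℂ] H') ≃ₗᵢ⋆[ℂ] (H' →L[ℂ] H))).comp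
      (continuous_isometry_comp_compact hs (isCompactOperator_adjoint hT))
  -- The compact operators carry the topology induced from the bounded operators, so continuity can
  -- be checked there in the operator norm.
  refine continuous_induced_rng.2 ?_
  rw [continuous_iff_continuousAt]
  intro x₀
  -- The family `V x` itself need not be norm continuous, so `V x` and `T (V x)⋆` cannot simply be
  -- multiplied. Instead `V x T (V x)⋆` is split as `V x T (V x₀)⋆` plus `V x (T (V x)⋆ - T (V
  -- x₀)⋆)`: the first summand is continuous because its right factor is frozen at `x₀`.
  have h3 : Continuous fun x => (V x).toIso.toContinuousLinearMap ∘L toOp T ∘L (V x₀).adj := by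
    exact h1.clm_comp continuous_const
  have h4 : ∀ x, toOp T ∘L (V x).adj =
      adjoint ((V x).toIso.toContinuousLinearMap ∘L adjoint (toOp T)) := fun x => by
    rw [adjoint_comp, adjoint_adjoint, Hom.adj]
  have h5 : Continuous fun x => toOp T ∘L (V x).adj := by
    simp only [h4]
    exact h2
  -- The second summand tends to zero because `‖V x‖ ≤ 1`, so only the norm continuity of `T (V x)⋆`
  -- matters.
  have h6 : Filter.Tendsto (fun x => (V x).toIso.toContinuousLinearMap ∘L
      (toOp T ∘L (V x).adj - toOp T ∘L (V x₀).adj)) (𝓝 x₀) (𝓝 0) := by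
    have h7 := tendsto_iff_norm_sub_tendsto_zero.1 (h5.tendsto x₀)
    refine squeeze_zero_norm (fun x => ?_) h7
    refine (opNorm_comp_le _ _).trans (mul_le_of_le_one_left (norm_nonneg _) ?_)
    exact (V x).toIso.norm_toContinuousLinearMap_le
  have h8 := h6.add (h3.tendsto x₀)
  rw [zero_add] at h8
  refine h8.congr fun x => ?_
  rw [comp_sub, sub_add_cancel]
  rfl

end GradedHilbert

/-! ### Maximal graded tensor products of homomorphisms -/

namespace GradedCStarAlg

/-- Every `*`-homomorphism of C*-algebras is contractive. The constant `1` does not depend on `f`,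
so an approximation of an argument serves a whole family of homomorphisms at once. -/
theorem Hom.dist_apply_le {A : GradedCStarAlg.{u} IsReal} {B : GradedCStarAlg.{v} IsReal}
    (f : Hom A B) (a a' : A) : dist (f a) (f a') ≤ dist a a' := by
  rw [dist_eq_norm, dist_eq_norm, ← map_sub]
  exact f.norm_apply_le _

variable {A B A' B' : GradedCStarAlg.{u} IsReal}

/-- The even part is the average of `b` and its image under the grading, which is contractive as a
`*`-homomorphism; the odd part below is bounded in the same way. -/
theorem norm_even_le (b : B) : ‖B.even b‖ ≤ ‖b‖ := by
  rw [even_apply, norm_smul, norm_inv, Complex.norm_ofNat]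
  have h := norm_add_le b (B.grading b)
  have h' : ‖B.grading b‖ ≤ ‖b‖ := B.gradingHom.norm_apply_le b
  linarith

theorem norm_odd_le (b : B) : ‖B.odd b‖ ≤ ‖b‖ := by
  rw [odd_apply, norm_smul, norm_inv, Complex.norm_ofNat]
  have h := norm_sub_le b (B.grading b)
  have h' : ‖B.grading b‖ ≤ ‖b‖ := B.gradingHom.norm_apply_le b
  linarith

namespace AlgTensor

/-- Splitting `b` into its even and odd parts reduces this to the bounds obtained from the
C*-identity and the contractive multiplier actions of `A` and `B`. Each part contributes at most
`‖a‖ * ‖b‖`, whence the factor `2`. Any constant independent of `a` and `b` would do, as the bound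
serves only to make `⊗` continuous. -/
theorem seminorm_tmul_le (p : CStarSeminorm (AlgTensor A B)) (a : A) (b : B) :
    p (tmul a b) ≤ 2 * (‖a‖ * ‖b‖) := by
  have h1 := (le_of_even p a b).trans
    (mul_le_mul_of_nonneg_left (norm_even_le b) (norm_nonneg _))
  -- An odd second factor twists the involution by the grading of `A`, so the bound involves
  -- `‖A.grading a‖`, which is at most `‖a‖`.
  have h2 := (le_of_odd p a b).trans (mul_le_mul (A.gradingHom.norm_apply_le a) (norm_odd_le b)
    (norm_nonneg _) (norm_nonneg _))
  have h3 := p.add_le (tmul a (B.even b)) (tmul a (B.odd b))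
  rw [← tmul_add, even_add_odd] at h3
  linarith

/-- The canonical bilinear map to a completion of the algebraic graded tensor product is jointly
continuous. -/
theorem continuous_of_tmul (p : CStarSeminorm (AlgTensor A B)) :
    Continuous fun q : A × B => p.of (tmul q.1 q.2) := by
  -- A bilinear map with a norm bound is jointly continuous. The ascription views `p.of` as a map on
  -- the bare tensor product underlying `AlgTensor A B`, where the universal bilinear map lives.
  let m : A →ₗ[ℂ] B →ₗ[ℂ] p.Completion :=
    (TensorProduct.mk ℂ A B).compr₂ (p.of : A ⊗[ℂ] B →ₗ[ℂ] p.Completion)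
  have hm : ∀ a b, ‖m a b‖ ≤ 2 * ‖a‖ * ‖b‖ := fun a b => by
    rw [mul_assoc]
    exact (p.norm_of _).trans_le (seminorm_tmul_le p a b)
  exact (m.mkContinuous₂ 2 hm).continuous₂

end AlgTensor

/-- The homomorphism `f ⊗̂ g` depends continuously on `f` and `g` in the point-norm topology. -/
theorem continuous_tensorHom {X : Type*} [TopologicalSpace X] {f : X → Hom A A'}
    (hf : Continuous f) {g : X → Hom B B'} (hg : Continuous g) :
    Continuous fun x => tensorHom (f x) (g x) := by
  rw [continuous_pointNorm_iff] at *
  have halg : ∀ r : AlgTensor A B,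
      Continuous fun x => tensorMap (f x) (g x) ((AlgTensor.maxSeminorm A B).of r) := by
    intro r
    simp only [tensorMap_of]
    induction r using AlgTensor.induction with
    | zero => simpa only [map_zero] using continuous_const
    | tmul a b =>
      exact (AlgTensor.continuous_of_tmul (AlgTensor.maxSeminorm A' B')).comp
        ((hf a).prodMk (hg b))
    | add r s hr hs =>
      simp only [map_add]
      exact hr.add hs
  intro z
  -- A uniform limit of continuous functions is continuous. If `r` is an algebraic tensor within `ε`
  -- of `z`, then the values at `r` and `z` differ by less than `ε` for all `x` simultaneously,
  -- since every `f x ⊗̂ g x` is contractive.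
  refine continuous_of_uniform_approx_of_continuous fun U hU => ?_
  obtain ⟨ε, hε, hεU⟩ := Metric.mem_uniformity_dist.1 hU
  obtain ⟨r, hr⟩ := (AlgTensor.maxSeminorm A B).denseRange_of.exists_dist_lt z hε
  refine ⟨_, halg r, fun x => hεU ?_⟩
  refine lt_of_le_of_lt ?_ hr
  exact (tensorHom (f x) (g x)).dist_apply_le _ _

end GradedCStarAlg

end SpectralKTheory

/-! ### Reduction of the enrichment to point-norm continuity -/

/-- `k𝕂` is a topologically enriched functor from graded C*-algebras (with the k-ification of the
point-norm topology) times graded separable Hilbert spaces and even isometries (with the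
k-ification of the strong-`*` topology) to pointed compactly generated spaces. Here `IsReal = True`
gives the version with Real structures, and `IsReal = False` the complex version. -/
theorem mainTheorem12 (IsReal : Prop) :
    SpectralKTheory.IsTopEnrichedFunctor (SpectralKTheory.kSpectralK.{u} IsReal) := by
  intro P Q
  -- Restricting to a compact Hausdorff `K` removes the k-ification of the product on the source
  -- side and that of the compact-open topology on the target side.
  refine SpectralKTheory.continuous_of_probes fun K g hg =>
    SpectralKTheory.continuous_kify_of_probe K ?_
  -- After uncurrying, the domain `K × L` is itself compact Hausdorff and lies in the same universe
  -- as the test spaces, so the k-ified topology on `𝕂(B, H')` may be replaced by the point-norm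
  -- topology.
  refine (SpectralKTheory.PointedCG.continuous_compactOpen_iff K).2 fun L a =>
    SpectralKTheory.continuous_kify_of_probe (CompHaus.of (K × L)) ?_
  -- The abstract morphism types of the categories are read as concrete types of homomorphisms and
  -- isometries, so that continuity refers to the point-norm and strong-`*` topologies. The same is
  -- done for the points of the source space.
  have h1 : Continuous fun k => (show SpectralKTheory.GradedCStarAlg.Hom P.1 Q.1 from (g k).1) :=
    SpectralKTheory.continuous_fst_of_kify hg
  have h2 : Continuous fun k => (show SpectralKTheory.GradedHilbert.Hom P.2 Q.2 from (g k).2) :=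
    SpectralKTheory.continuous_snd_of_kify hg
  have h3 : Continuous fun l => (show SpectralKTheory.GradedCStarAlg.Hom
      (SpectralKTheory.S IsReal) (SpectralKTheory.GradedCStarAlg.tensor P.1
        (SpectralKTheory.GradedHilbert.compacts P.2)) from a l) :=
    SpectralKTheory.continuous_of_kify a.continuous
  -- Here `ψ` varies over `L` while `φ` and `V` vary over `K`; joint continuity of composition
  -- combines the two families over `K × L`.
  exact SpectralKTheory.GradedCStarAlg.continuous_hom_comp (h3.comp continuous_snd)
    (SpectralKTheory.GradedCStarAlg.continuous_tensorHom (h1.comp continuous_fst)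
      (SpectralKTheory.GradedHilbert.continuous_Ad (h2.comp continuous_fst)))
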